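/- Let $n\ge 2$, let $0<c<n-1$, put $\pi=c/(n-1)$, and let $K$ be the random graph on the vertex set $\{1,\dots,n\}$ in which each pair of distinct vertices is an edge with probability $\pi$, independently of all other pairs. Let $p\ge 1$, let $d_1,\dots,d_p$ be distinct nonnegative integers, let $W_i$ be the number of vertices of $K$ of degree $d_i$, and let $W=(W_1,\dots,W_p)$. Put $$\beta(i)=\binom{n-1}{d_i}\pi^{d_i}(1-\pi)^{n-1-d_i}.$$ (a) The mean $\lambda=EW$ and the covariance matrix $\Sigma=\operatorname{Var}W=(\sigma_{ij})$ are $$\lambda_i=n\beta(i),\qquad \sigma_{ij}=n\beta(i)\beta(j)\left[\frac{(d_i-c)(d_j-c)}{c(1-c/(n-1))}-1\right]+\delta_{ij}\,n\beta(i),$$ where $\delta_{ij}=1$ if $i=j$ and $\delta_{ij}=0$ otherwise. If all $\beta(i)>0$ and $\sum_{i}\beta(i)<1$, then $\Sigma$ is positive definite. (b) There is a universal constant $M$, not depending on $n$, $p$, $c$, $d_1,\dots,d_p$ or $h$, such that the following holds whenever all $\beta(i)>0$ and $\sum_i\beta(i)<1$. Put $$B=\frac{1}{\min_i\beta(i)\,\bigl(1-\sum_{i=1}^p\beta(i)\bigr)}.$$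 Then for every $h:\mathbb R^p\to\mathbb R$ whose mixed partial derivatives of orders $1$, $2$ and $3$ exist everywhere and are bounded, $$\left|E\,h\bigl(\Sigma^{-1/2}(W-\lambda)\bigr)-E\,h(Z)\right|\le n^{-1/2}M\left\{p^3B\,\|D^2h\|\,(1+c^{5/2})\left(\frac{n-1}{n-1-c}\right)^{1/2}+p^5B^{3/2}\,\|D^3h\|\,(1+c^2)\right\},$$ where $Z$ is a standard normal vector in $\mathbb R^p$ (mean zero, identity covariance), $\Sigma^{-1/2}$ is the inverse of the positive definite square root of $\Sigma$, and $\|D^kh\|$ is the supremum over $w\in\mathbb R^p$ of the largest absolute value of the $k$-th order partial derivatives of $h$ at $w$. (c) For fixed $c>0$ and fixed distinct $d_1,\dots,d_p$, with $\pi=\pi_n=c/(n-1)$, the vector $\Sigma^{-1/2}(W-\lambda)$ (which is defined for all large $n$) converges in distribution to $Z$ as $n\to\infty$. -/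

import Mathlib

open MeasureTheory ProbabilityTheory Filter
open scoped SimpleGraph

namespace DegreeCounts

noncomputable section

/-- The edge probability `π = c / (n - 1)`, as a point of `[0, 1]`.
(For `0 < c < n - 1`, this is the number `c / (n - 1)` itself; otherwise it is truncated.) -/
def edgeProb (n : ℕ) (c : ℝ) : unitInterval :=
  Set.projIcc 0 1 zero_le_one (c / ((n : ℝ) - 1))

/-- The law of the random graph on `n` labelled vertices in which the pairs of distinct vertices
are edges independently of each other, each with probability `π = c / (n - 1)`. -/
abbrev graphLaw (n : ℕ) (c : ℝ) : Measure (SimpleGraph (Fin n)) :=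
  G(Fin n, edgeProb n c)

open Classical in
/-- The vector `W = (W_1, …, W_p)`: `W_i` is the number of vertices of `G` of degree `d_i`. -/
def degreeCount {n p : ℕ} (d : Fin p → ℕ) (G : SimpleGraph (Fin n)) (i : Fin p) : ℝ :=
  ((Finset.univ.filter fun v : Fin n => G.degree v = d i).card : ℝ)

/-- The mean vector `λ = E W`. -/
def meanVec {p : ℕ} (n : ℕ) (c : ℝ) (d : Fin p → ℕ) (i : Fin p) : ℝ :=
  ∫ G, degreeCount d G i ∂(graphLaw n c)

/-- The covariance matrix `Σ = Var W`. -/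
def covMatrix {p : ℕ} (n : ℕ) (c : ℝ) (d : Fin p → ℕ) : Matrix (Fin p) (Fin p) ℝ :=
  Matrix.of fun i j =>
    cov[fun G => degreeCount d G i, fun G => degreeCount d G j; graphLaw n c]

open scoped MatrixOrder in
/-- `A ^ (-1/2)` for a positive definite matrix `A`: the inverse of its positive semidefinite
square root. -/
def invSqrt {p : ℕ} (A : Matrix (Fin p) (Fin p) ℝ) : Matrix (Fin p) (Fin p) ℝ :=
  (CFC.sqrt A)⁻¹

/-- The standardized vector `Σ ^ (-1/2) (W - λ)`. -/
def standardized {p : ℕ} (n : ℕ) (c : ℝ) (d : Fin p → ℕ) (G : SimpleGraph (Fin n)) : Fin p → ℝ :=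
  (invSqrt (covMatrix n c d)).mulVec (degreeCount d G - meanVec n c d)

/-- The law of a standard normal vector in `ℝ ^ p` (mean zero, covariance the identity). -/
abbrev stdNormal (p : ℕ) : Measure (Fin p → ℝ) :=
  Measure.pi fun _ => gaussianReal 0 1

/-- `β(i) = C(n-1, d_i) π ^ d_i (1 - π) ^ (n - 1 - d_i)` with `π = c / (n - 1)`. -/
def beta {p : ℕ} (n : ℕ) (c : ℝ) (d : Fin p → ℕ) (i : Fin p) : ℝ :=
  ((n - 1).choose (d i) : ℝ) * (c / ((n : ℝ) - 1)) ^ d i *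
    (1 - c / ((n : ℝ) - 1)) ^ (n - 1 - d i)

/-- `B = 1 / (min_i β(i) * (1 - ∑_i β(i)))`. -/
def bigB {p : ℕ} (n : ℕ) (c : ℝ) (d : Fin p → ℕ) : ℝ :=
  1 / ((⨅ i, beta n c d i) * (1 - ∑ i, beta n c d i))

/-- The mixed partial derivative `∂_{i_1} (∂_{i_2} (⋯ (∂_{i_k} h)))` for `l = [i_1, …, i_k]`. -/
def mixedPartial {p : ℕ} (h : (Fin p → ℝ) → ℝ) : List (Fin p) → (Fin p → ℝ) → ℝ
  | [] => h
  | i :: l => fun w => lineDeriv ℝ (mixedPartial h l) w (Pi.single i 1)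

/-- All mixed partial derivatives of `h` of order `1, 2, 3` exist everywhere and are bounded. -/
structure HasBoundedPartials {p : ℕ} (h : (Fin p → ℝ) → ℝ) : Prop where
  exist : ∀ (i : Fin p) (l : List (Fin p)), l.length < 3 →
    ∀ w, LineDifferentiableAt ℝ (mixedPartial h l) w (Pi.single i 1)
  bounded : ∀ l : List (Fin p), 1 ≤ l.length → l.length ≤ 3 →
    ∃ C : ℝ, ∀ w, |mixedPartial h l w| ≤ C

/-- `‖D^k h‖`: the supremum over the space of the largest absolute value of the partial
derivatives of order `k`. -/
def derivNorm {p : ℕ} (k : ℕ) (h : (Fin p → ℝ) → ℝ) : ℝ :=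
  ⨆ q : (Fin k → Fin p) × (Fin p → ℝ), |mixedPartial h (List.ofFn q.1) q.2|

end

end DegreeCounts

/-! The argument is an exchange form of Stein's method combined with a Gaussian interpolation. Take
an independent copy `G'` of the graph `G` and swap the edges at one vertex `v` between the two. This
involution preserves the joint law, so E φ(deg_G v) f(G) equals the mean of φ(deg_{G'} v) f(graft of
the star of `G'` onto `G`). Summing over `v` and centring expresses E (W_i - λ_i) f(G) through
increments of f under grafting (`graphMean_degSum_sub_mul`).

The class of vertex sums ∑_v ψ(deg v) is closed under this operation: the increment of such a sum,
averaged over `G'` and summed over `v`, is a constant plus another sum of the same type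
(`sum_graphMean_increment`). Taking means, with the birth-death identities of the binomial law,
gives every covariance of vertex sums exactly (`graphMean_degSum_mul_degSum`). This yields Σ, and
also shows that the conditional drift, being a vertex sum itself, fluctuates around Σ only by order
√n. Positive definiteness is Cauchy–Schwarz, with the quantitative form x·Σx ≥ (n/B)|x|², so the
entries of A = Σ^(-1/2) are at most √(B/n).

For the error bound, let X = A(W - λ) and differentiate E h(sin θ X + cos θ Z) in θ. Gaussian
integration by parts handles Z. For X, the exchange identity followed by a Taylor expansion to
second order produces the trace of the Hessian, because A Σ Aᵀ = 1, up to two errors: the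
fluctuation of the drift (with the second derivatives of h) and the squared increments (with the
third). Integrating over [0, π/2] gives the bound (`Exchange.abs_sum_sub_integral_le`).

For fixed c and d the β(i) tend to Poisson probabilities, so B stays bounded. Applying the bound to
cosines of linear forms gives convergence of characteristic functions, hence in distribution. -/

namespace DegreeCounts

set_option linter.unusedSectionVars false

/-! ### Finite sums over random graphs and the law of one degree -/

section GraphSums

variable {V : Type*} [Fintype V] [DecidableEq V]

/-- Makes the finite space of graphs discrete, so that every function on it is measurable and
integrals are finite sums. -/
instance : MeasurableSingletonClass (SimpleGraph V) where
  measurableSet_singleton G := by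
    rw [← SimpleGraph.measurableEmbedding_edgeSet.measurableSet_image, Set.image_singleton]
    exact measurableSet_singleton _

open Classical in
/-- The probability of the graph `G` when edges are present independently with probability `q`. -/
noncomputable def graphWeight (q : ℝ) (G : SimpleGraph V) : ℝ :=
  ∏ e ∈ (⊤ : SimpleGraph V).edgeFinset, if e ∈ G.edgeSet then q else 1 - q

open Classical in
/-- The degree of a vertex, with classical decidability. -/
noncomputable def deg (G : SimpleGraph V) (v : V) : ℕ := G.degree v

-- Expanding the product chooses one summand per edge, and such a choice is a graph. This carries
-- the independence of the edges throughout.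
open Classical in
theorem sum_prod_edges {R : Type*} [CommSemiring R] (x y : Sym2 V → R) :
    ∑ G : SimpleGraph V, ∏ e ∈ (⊤ : SimpleGraph V).edgeFinset,
      (if e ∈ G.edgeSet then x e else y e) =
    ∏ e ∈ (⊤ : SimpleGraph V).edgeFinset, (x e + y e) := by
  rw [Finset.prod_add]
  refine Finset.sum_bij' (fun G _ => G.edgeFinset)
    (fun s _ => SimpleGraph.fromEdgeSet (s : Set (Sym2 V))) ?_ ?_ ?_ ?_ ?_
  · intro G _
    simp only [Finset.mem_powerset]
    exact SimpleGraph.edgeFinset_mono le_top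
  · intro s _; simp
  · intro G _; simp
  · intro s hs
    ext e
    simp only [Finset.mem_powerset] at hs
    simp only [SimpleGraph.mem_edgeFinset, SimpleGraph.edgeSet_fromEdgeSet]
    constructor
    · intro h; exact_mod_cast h.1
    · intro h
      have := hs h
      simp at this
      exact ⟨by exact_mod_cast h, by simpa using this⟩
  · intro G _
    rw [← Finset.prod_sdiff (SimpleGraph.edgeFinset_mono (le_top : G ≤ ⊤)), mul_comm]
    congr 1
    · exact Finset.prod_congr rfl fun e he => by
        rw [if_pos (by simpa using he)]
    · exact Finset.prod_congr rfl fun e he => by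
        rw [if_neg (by simp at he; simpa using he.2)]

theorem sum_graphWeight (q : ℝ) : ∑ G : SimpleGraph V, graphWeight q G = 1 := by
  classical
  have := sum_prod_edges (V := V) (fun _ => q) (fun _ => 1 - q)
  simp only [add_sub_cancel, Finset.prod_const_one] at this
  rw [← this]; unfold graphWeight
  rfl

theorem graphWeight_nonneg {q : ℝ} (h0 : 0 ≤ q) (h1 : q ≤ 1) (G : SimpleGraph V) :
    0 ≤ graphWeight q G :=
  Finset.prod_nonneg fun _ _ => by split_ifs <;> linarith

theorem integral_binomialRandom (q : unitInterval) (f : SimpleGraph V → ℝ) :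
    ∫ G, f G ∂(SimpleGraph.binomialRandom V q) = ∑ G, graphWeight (q : ℝ) G * f G := by
  classical
  rw [integral_fintype .of_finite]
  refine Finset.sum_congr rfl fun G _ => ?_
  rw [smul_eq_mul]
  congr 1
  rw [Measure.real, SimpleGraph.binomialRandom_singleton, graphWeight, Finset.prod_ite,
    Finset.prod_const, Finset.prod_const]
  have h1 : ((⊤ : SimpleGraph V).edgeFinset.filter (· ∈ G.edgeSet)) = G.edgeFinset := by
    ext e
    simp only [Finset.mem_filter, SimpleGraph.mem_edgeFinset]
    exact ⟨fun h => h.2, fun h => ⟨SimpleGraph.edgeSet_mono le_top h, h⟩⟩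
  have h2 : ((⊤ : SimpleGraph V).edgeFinset.filter (· ∉ G.edgeSet)).card =
      (Nat.card V).choose 2 - G.edgeSet.ncard := by
    rw [Finset.filter_not, h1, Finset.card_sdiff_of_subset
      (SimpleGraph.edgeFinset_mono le_top), SimpleGraph.card_edgeFinset_top_eq_card_choose_two,
      ← SimpleGraph.coe_edgeFinset, Set.ncard_coe_finset, Nat.card_eq_fintype_card]
  rw [h1, h2, ← SimpleGraph.coe_edgeFinset, Set.ncard_coe_finset]
  simp

/-- The binomial probabilities. -/
noncomputable def binomProb (q : ℝ) (N k : ℕ) : ℝ := (N.choose k : ℝ) * q ^ k * (1 - q) ^ (N - k)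

/-- The expectation of `g D` for `D` binomial with parameters `N` and `q`. -/
noncomputable def binomMean (q : ℝ) (N : ℕ) (g : ℕ → ℝ) : ℝ :=
  ∑ k ∈ Finset.range (N + 1), binomProb q N k * g k

open Polynomial in
theorem coeff_binomial (q : ℝ) (N k : ℕ) :
    ((C q * X + C (1 - q)) ^ N : ℝ[X]).coeff k = binomProb q N k := by
  have h : ((C q * X + C (1 - q)) ^ N : ℝ[X]) =
      ∑ m ∈ Finset.range (N + 1), C (binomProb q N m) * X ^ m := by
    rw [add_pow]
    refine Finset.sum_congr rfl fun m _ => ?_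
    simp only [binomProb, mul_pow, map_mul, map_pow, map_natCast]
    ring
  rw [h, finsetSum_coeff]
  simp only [coeff_C_mul_X_pow]
  rw [Finset.sum_ite_eq]
  split_ifs with hk
  · rfl
  · have : N < k := by simpa using hk
    simp [binomProb, Nat.choose_eq_zero_of_lt this]

open Classical in
theorem edgeFinset_top_filter_mem_card (v : V) :
    ((⊤ : SimpleGraph V).edgeFinset.filter (v ∈ ·)).card = Fintype.card V - 1 := by
  rw [← SimpleGraph.complete_graph_degree v, ← SimpleGraph.card_incidenceFinset_eq_degree]
  congr 1
  ext e
  simp [SimpleGraph.incidenceSet]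

open Classical in
theorem deg_eq_card_filter (G : SimpleGraph V) (v : V) :
    deg G v = ((⊤ : SimpleGraph V).edgeFinset.filter fun e => e ∈ G.edgeSet ∧ v ∈ e).card := by
  rw [deg, ← SimpleGraph.card_incidenceFinset_eq_degree]
  congr 1
  ext e
  simp only [SimpleGraph.mem_incidenceFinset, SimpleGraph.incidenceSet, Finset.mem_filter,
    SimpleGraph.mem_edgeFinset]
  exact ⟨fun h => ⟨SimpleGraph.edgeSet_mono le_top h.1, h⟩, fun h => h.2⟩

theorem deg_lt_card [Nonempty V] (G : SimpleGraph V) (v : V) :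
    deg G v < Fintype.card V - 1 + 1 := by
  classical
  have := G.degree_lt_card_verts v
  unfold deg
  convert (show G.degree v < Fintype.card V - 1 + 1 by omega)

-- The generating function of the degree factors over edges: each edge at `v` contributes `q X + (1
-- - q)`, every other edge contributes 1. Comparing coefficients then shows that the degree is
-- binomial.
open Polynomial in
theorem sum_graphWeight_mul_X_pow_deg (q : ℝ) (v : V) :
    ∑ G : SimpleGraph V, C (graphWeight q G) * X ^ deg G v =
      (C q * X + C (1 - q)) ^ (Fintype.card V - 1) := by
  classical
  have h := sum_prod_edges (V := V) (fun e => C q * (if v ∈ e then (X : ℝ[X]) else 1))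
    (fun _ => C (1 - q))
  rw [← edgeFinset_top_filter_mem_card v]
  have h2 : ∏ e ∈ (⊤ : SimpleGraph V).edgeFinset,
      (C q * (if v ∈ e then (X : ℝ[X]) else 1) + C (1 - q)) =
      (C q * X + C (1 - q)) ^ ((⊤ : SimpleGraph V).edgeFinset.filter (v ∈ ·)).card := by
    rw [← Finset.prod_const, Finset.prod_filter]
    refine Finset.prod_congr rfl fun e _ => ?_
    split_ifs
    · rfl
    · rw [mul_one, ← map_add]; simp
  rw [← h2, ← h]
  refine Finset.sum_congr rfl fun G _ => ?_
  rw [deg_eq_card_filter, ← Finset.prod_const, Finset.prod_filter, graphWeight, map_prod,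
    ← Finset.prod_mul_distrib]
  refine Finset.prod_congr rfl fun e _ => ?_
  by_cases h1 : e ∈ G.edgeSet <;> by_cases h2 : v ∈ e <;> simp [h1, h2]

theorem sum_graphWeight_mul_deg (q : ℝ) (v : V) (g : ℕ → ℝ) :
    ∑ G : SimpleGraph V, graphWeight q G * g (deg G v) =
      binomMean q (Fintype.card V - 1) g := by
  classical
  have : Nonempty V := ⟨v⟩
  have h : ∀ k, ∑ G : SimpleGraph V, graphWeight q G * (if deg G v = k then 1 else 0) =
      binomProb q (Fintype.card V - 1) k := by
    intro k
    rw [← coeff_binomial, ← sum_graphWeight_mul_X_pow_deg q v, Polynomial.finsetSum_coeff]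
    refine Finset.sum_congr rfl fun G _ => ?_
    rw [Polynomial.coeff_C_mul_X_pow]
    by_cases hk : deg G v = k
    · simp [hk]
    · simp [hk, Ne.symm hk]
  simp only [binomMean, ← h, Finset.sum_mul]
  rw [Finset.sum_comm]
  refine Finset.sum_congr rfl fun G _ => ?_
  simp only [mul_assoc, ← Finset.mul_sum]
  congr 1
  rw [Finset.sum_eq_single (deg G v)]
  · simp
  · intro k _ hk; simp [Ne.symm hk]
  · intro hk; exact absurd (Finset.mem_range.2 (deg_lt_card G v)) hk

open Classical in
/-- The indicator of adjacency. -/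
noncomputable def adjInd (G : SimpleGraph V) (u v : V) : ℝ := if G.Adj u v then 1 else 0

theorem adjInd_self (G : SimpleGraph V) (u : V) : adjInd G u u = 0 := by simp [adjInd]

theorem adjInd_comm (G : SimpleGraph V) (u v : V) : adjInd G u v = adjInd G v u := by
  by_cases h : G.Adj u v
  · simp [adjInd, h, h.symm]
  · have h' : ¬G.Adj v u := fun h' => h h'.symm
    simp [adjInd, h, h']

theorem sum_adjInd (G : SimpleGraph V) (v : V) : ∑ u, adjInd G v u = deg G v := by
  classical
  rw [deg, ← SimpleGraph.card_neighborFinset_eq_degree, SimpleGraph.neighborFinset_eq_filter]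
  simp [adjInd]

theorem graphWeight_comap (q : ℝ) (σ : Equiv.Perm V) (G : SimpleGraph V) :
    graphWeight q (G.comap σ) = graphWeight q G := by
  classical
  unfold graphWeight
  refine Finset.prod_bij' (fun e _ => e.map σ) (fun e _ => e.map σ.symm) ?_ ?_ ?_ ?_ ?_
  · rintro ⟨a, b⟩; simp
  · rintro ⟨a, b⟩; simp
  · intro e _; simp [Sym2.map_map]
  · intro e _; simp [Sym2.map_map]
  · rintro ⟨a, b⟩ _; simp

theorem deg_comap (σ : Equiv.Perm V) (G : SimpleGraph V) (v : V) :
    deg (G.comap σ) v = deg G (σ v) := by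
  classical
  unfold deg
  exact (SimpleGraph.Iso.degree_eq (SimpleGraph.Iso.comap σ G) v).symm

theorem sum_comap (σ : Equiv.Perm V) (f : SimpleGraph V → ℝ) :
    ∑ G : SimpleGraph V, f (G.comap σ) = ∑ G, f G := by
  refine Function.Bijective.sum_comp ?_ f
  refine Function.bijective_iff_has_inverse.2 ⟨fun G => G.comap σ.symm, ?_, ?_⟩ <;>
  · intro G; ext a b; simp

/-- Transposing `u` with another vertex while fixing `v` shows that all potential neighbours of `v`
contribute equally, and together their indicators sum to the degree. -/
theorem sum_graphWeight_mul_deg_mul_adjInd (q : ℝ) {u v : V} (huv : u ≠ v) (g : ℕ → ℝ) :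
    ((Fintype.card V : ℝ) - 1) *
      ∑ G : SimpleGraph V, graphWeight q G * (g (deg G v) * adjInd G v u) =
      binomMean q (Fintype.card V - 1) fun k => g k * k := by
  classical
  rw [← sum_graphWeight_mul_deg q v]
  simp only [← sum_adjInd]
  have h : ∀ w ∈ Finset.univ.erase v,
      ∑ G : SimpleGraph V, graphWeight q G * (g (deg G v) * adjInd G v w) =
      ∑ G : SimpleGraph V, graphWeight q G * (g (deg G v) * adjInd G v u) := by
    intro w hw
    rw [← sum_comap (Equiv.swap u w)]
    refine Finset.sum_congr rfl fun G _ => ?_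
    have hv : Equiv.swap u w v = v :=
      Equiv.swap_apply_of_ne_of_ne huv.symm (Finset.ne_of_mem_erase hw).symm
    rw [graphWeight_comap, deg_comap, hv]
    simp [adjInd, hv]
  simp only [Finset.mul_sum]
  rw [Finset.sum_comm]
  simp only [← Finset.mul_sum]
  rw [← Finset.add_sum_erase _ _ (Finset.mem_univ v), Finset.sum_congr rfl h]
  simp only [adjInd_self, mul_zero, Finset.sum_const_zero, zero_add, Finset.sum_const,
    Finset.card_erase_of_mem (Finset.mem_univ v), Finset.card_univ, nsmul_eq_mul]
  rw [Nat.cast_sub (Fintype.card_pos_iff.2 ⟨v⟩)]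
  simp [adjInd]

end GraphSums

/-! ### Moments and birth-death identities of the binomial law -/

section Binomial

theorem binomMean_add (q : ℝ) (N : ℕ) (f g : ℕ → ℝ) :
    binomMean q N (fun k => f k + g k) = binomMean q N f + binomMean q N g := by
  simp only [binomMean, mul_add, Finset.sum_add_distrib]

theorem binomMean_sub (q : ℝ) (N : ℕ) (f g : ℕ → ℝ) :
    binomMean q N (fun k => f k - g k) = binomMean q N f - binomMean q N g := by
  simp only [binomMean, mul_sub, Finset.sum_sub_distrib]

theorem binomMean_const_mul (q : ℝ) (N : ℕ) (a : ℝ) (f : ℕ → ℝ) :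
    binomMean q N (fun k => a * f k) = a * binomMean q N f := by
  simp only [binomMean, Finset.mul_sum]
  exact Finset.sum_congr rfl fun _ _ => by ring

/-- Detailed balance for the chain with birth rate q(N - k) and death rate (1 - q)k. The next two
mean identities are its summed forms. -/
theorem binomProb_succ (q : ℝ) (N k : ℕ) :
    binomProb q N (k + 1) * (k + 1) * (1 - q) = q * ((N - k) * binomProb q N k) := by
  have h := Nat.choose_succ_right_eq N k
  rcases lt_trichotomy k N with hk | rfl | hk
  · obtain ⟨r, rfl⟩ := Nat.exists_eq_add_of_lt hk
    have e1 : k + r + 1 - k = r + 1 := by omega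
    have e2 : k + r + 1 - (k + 1) = r := by omega
    rw [e1] at h
    have h' : (((k + r + 1).choose (k + 1) : ℕ) : ℝ) * (k + 1) =
        ((k + r + 1).choose k) * (r + 1) := by
      exact_mod_cast h
    simp only [binomProb, e1, e2]
    push_cast
    linear_combination q ^ (k + 1) * (1 - q) ^ (r + 1) * h'
  · simp [binomProb]
  · simp [binomProb, Nat.choose_eq_zero_of_lt hk,
      Nat.choose_eq_zero_of_lt (hk.trans (Nat.lt_succ_self k))]

theorem binomMean_mul_pred (q : ℝ) (N : ℕ) (ψ : ℕ → ℝ) :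
    (1 - q) * binomMean q N (fun k => k * ψ (k - 1)) =
      q * (N * binomMean q N ψ - binomMean q N (fun k => k * ψ k)) := by
  rw [← binomMean_const_mul q N N, ← binomMean_sub]
  simp only [binomMean]
  -- The left side has no term at 0 and the right side none at `N`, so the remaining terms match
  -- after a shift by one.
  rw [Finset.sum_range_succ', Finset.sum_range_succ]
  simp only [Nat.cast_zero, zero_mul, mul_zero, add_zero, sub_self, Nat.add_sub_cancel]
  rw [Finset.mul_sum, Finset.mul_sum]
  refine Finset.sum_congr rfl fun k _ => ?_
  have := binomProb_succ q N k
  push_cast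
  linear_combination ψ k * this

theorem binomMean_mul_succ (q : ℝ) (N : ℕ) (ψ : ℕ → ℝ) :
    q * binomMean q N (fun k => (N - k) * ψ (k + 1)) =
      (1 - q) * binomMean q N (fun k => k * ψ k) := by
  simp only [binomMean]
  rw [Finset.sum_range_succ, Finset.sum_range_succ']
  simp only [Nat.cast_zero, zero_mul, mul_zero, add_zero, sub_self]
  rw [Finset.mul_sum, Finset.mul_sum]
  refine Finset.sum_congr rfl fun k _ => ?_
  have := binomProb_succ q N k
  push_cast
  linear_combination -ψ (k + 1) * this

theorem binomMean_one (q : ℝ) (N : ℕ) : binomMean q N (fun _ => 1) = 1 := by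
  have h := congrArg (Polynomial.eval q) (bernsteinPolynomial.sum ℝ N)
  simp only [Polynomial.eval_finsetSum, bernsteinPolynomial] at h
  simpa [binomMean, binomProb] using h

theorem binomMean_sub_sq (q : ℝ) (N : ℕ) :
    binomMean q N (fun k => (k - N * q) ^ 2) = N * q * (1 - q) := by
  have h := congrArg (Polynomial.eval q) (bernsteinPolynomial.variance ℝ N)
  simp only [Polynomial.eval_finsetSum, bernsteinPolynomial] at h
  simp at h
  rw [← h]
  refine Finset.sum_congr rfl fun k _ => ?_
  simp only [binomProb]
  ring

theorem binomMean_id (q : ℝ) (N : ℕ) : binomMean q N (fun k => k) = N * q := by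
  have h := congrArg (Polynomial.eval q) (bernsteinPolynomial.sum_smul ℝ N)
  simp only [Polynomial.eval_finsetSum, bernsteinPolynomial] at h
  simp at h
  rw [← h]
  refine Finset.sum_congr rfl fun k _ => ?_
  simp only [binomProb]
  ring

theorem binomProb_nonneg {q : ℝ} (h0 : 0 ≤ q) (h1 : q ≤ 1) (N k : ℕ) : 0 ≤ binomProb q N k := by
  have : 0 ≤ 1 - q := by linarith
  unfold binomProb
  positivity

theorem binomMean_mono {q : ℝ} (h0 : 0 ≤ q) (h1 : q ≤ 1) {N : ℕ} {f g : ℕ → ℝ}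
    (h : ∀ k ≤ N, f k ≤ g k) : binomMean q N f ≤ binomMean q N g :=
  Finset.sum_le_sum fun k hk => mul_le_mul_of_nonneg_left
    (h k (Nat.lt_succ_iff.1 (Finset.mem_range.1 hk))) (binomProb_nonneg h0 h1 N k)

theorem binomMean_mul_sq_le {q : ℝ} (h0 : 0 ≤ q) (h1 : q ≤ 1) (N : ℕ) (f g : ℕ → ℝ) :
    binomMean q N (fun k => f k * g k) ^ 2 ≤
      binomMean q N (fun k => f k ^ 2) * binomMean q N (fun k => g k ^ 2) := by
  have h := Finset.sum_mul_sq_le_sq_mul_sq (Finset.range (N + 1))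
    (fun k => √(binomProb q N k) * f k) (fun k => √(binomProb q N k) * g k)
  have e : ∀ k, √(binomProb q N k) ^ 2 = binomProb q N k :=
    fun k => Real.sq_sqrt (binomProb_nonneg h0 h1 N k)
  simp only [mul_pow, e] at h
  refine le_trans (le_of_eq ?_) h
  simp only [binomMean]
  congr 1
  refine Finset.sum_congr rfl fun k _ => ?_
  linear_combination - f k * g k * e k

end Binomial

/-! ### Exchanging the star of a vertex with that of an independent copy -/

section Exchange

variable {V : Type*} [Fintype V] [DecidableEq V]

/-- The expectation of `f G` for a random graph `G` with edge probability `q`. -/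
noncomputable def graphMean (q : ℝ) (f : SimpleGraph V → ℝ) : ℝ :=
  ∑ G, graphWeight q G * f G

theorem graphMean_add (q : ℝ) (f g : SimpleGraph V → ℝ) :
    graphMean q (fun G => f G + g G) = graphMean q f + graphMean q g := by
  simp only [graphMean, mul_add, Finset.sum_add_distrib]

theorem graphMean_sub (q : ℝ) (f g : SimpleGraph V → ℝ) :
    graphMean q (fun G => f G - g G) = graphMean q f - graphMean q g := by
  simp only [graphMean, mul_sub, Finset.sum_sub_distrib]

theorem graphMean_const_mul (q : ℝ) (a : ℝ) (f : SimpleGraph V → ℝ) :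
    graphMean q (fun G => a * f G) = a * graphMean q f := by
  simp only [graphMean, Finset.mul_sum]
  exact Finset.sum_congr rfl fun _ _ => by ring

theorem graphMean_const (q a : ℝ) : graphMean q (fun _ : SimpleGraph V => a) = a := by
  simp only [graphMean, ← Finset.sum_mul, sum_graphWeight, one_mul]

theorem graphMean_sum {ι : Type*} (q : ℝ) (s : Finset ι) (f : ι → SimpleGraph V → ℝ) :
    graphMean q (fun G => ∑ i ∈ s, f i G) = ∑ i ∈ s, graphMean q (f i) := by
  simp only [graphMean, Finset.mul_sum]
  exact Finset.sum_comm

theorem graphMean_deg (q : ℝ) (v : V) (g : ℕ → ℝ) :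
    graphMean q (fun G => g (deg G v)) = binomMean q (Fintype.card V - 1) g :=
  sum_graphWeight_mul_deg q v g

/-- The graph `G` with the edges at `v` replaced by those of `G'`. -/
def graftStar (v : V) (G G' : SimpleGraph V) : SimpleGraph V where
  Adj a b := if v = a ∨ v = b then G'.Adj a b else G.Adj a b
  symm := ⟨fun a b h => by
    by_cases hv : v = a ∨ v = b
    · rw [if_pos hv] at h; rw [if_pos hv.symm]; exact h.symm
    · rw [if_neg hv] at h; rw [if_neg (fun h' => hv h'.symm)]; exact h.symm⟩
  loopless := ⟨fun a h => by split_ifs at h <;> exact absurd h (SimpleGraph.irrefl _)⟩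

theorem graftStar_adj (v : V) (G G' : SimpleGraph V) (a b : V) :
    (graftStar v G G').Adj a b ↔ if v = a ∨ v = b then G'.Adj a b else G.Adj a b := Iff.rfl

theorem graftStar_graftStar (v : V) (G G' : SimpleGraph V) :
    graftStar v (graftStar v G G') (graftStar v G' G) = G := by
  ext a b
  simp only [graftStar_adj]
  split_ifs <;> rfl

/-- Edge by edge, the two factors are either left alone or interchanged, so the product law on pairs
is invariant under the swap of stars. -/
theorem graphWeight_graftStar (q : ℝ) (v : V) (G G' : SimpleGraph V) :
    graphWeight q (graftStar v G G') * graphWeight q (graftStar v G' G) =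
      graphWeight q G * graphWeight q G' := by
  classical
  simp only [graphWeight, ← Finset.prod_mul_distrib]
  refine Finset.prod_congr rfl ?_
  rintro ⟨a, b⟩ _
  change (if (graftStar v G G').Adj a b then q else 1 - q) *
    (if (graftStar v G' G).Adj a b then q else 1 - q) =
    (if G.Adj a b then q else 1 - q) * (if G'.Adj a b then q else 1 - q)
  simp only [graftStar_adj]
  by_cases h : v = a ∨ v = b
  · simp only [h, if_true]; rw [mul_comm]
  · simp only [h, if_false]

theorem adjInd_congr {G G' : SimpleGraph V} {u v u' v' : V} (h : G.Adj u v ↔ G'.Adj u' v') :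
    adjInd G u v = adjInd G' u' v' := by
  by_cases h' : G.Adj u v
  · simp [adjInd, h', h.1 h']
  · simp [adjInd, h', mt h.2 h']

theorem deg_graftStar_self (v : V) (G G' : SimpleGraph V) :
    deg (graftStar v G G') v = deg G' v := by
  have h : (deg (graftStar v G G') v : ℝ) = deg G' v := by
    rw [← sum_adjInd, ← sum_adjInd]
    refine Finset.sum_congr rfl fun u _ => ?_
    exact adjInd_congr (by simp [graftStar_adj])
  exact_mod_cast h

theorem deg_graftStar_of_ne {u v : V} (huv : u ≠ v) (G G' : SimpleGraph V) :
    (deg (graftStar v G G') u : ℝ) = deg G u - adjInd G v u + adjInd G' v u := by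
  rw [← sum_adjInd, ← sum_adjInd, ← Finset.add_sum_erase _ _ (Finset.mem_univ v),
    ← Finset.add_sum_erase _ (fun w => adjInd G u w) (Finset.mem_univ v)]
  have h : ∀ w ∈ Finset.univ.erase v, adjInd (graftStar v G G') u w = adjInd G u w := by
    intro w hw
    have := Finset.ne_of_mem_erase hw
    exact adjInd_congr (by simp [graftStar_adj, huv.symm, this.symm])
  rw [Finset.sum_congr rfl h, adjInd_comm G v u, adjInd_comm G' v u]
  have : adjInd (graftStar v G G') u v = adjInd G' u v :=
    adjInd_congr (by simp [graftStar_adj])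
  rw [this]
  ring

/-- For `u ≠ v` only the edge `uv` can change at `u`: the degree drops by one if the edge is lost,
rises by one if it is gained. Truncated subtraction is harmless because a lost edge forces positive
degree. -/
theorem apply_deg_graftStar_of_ne {u v : V} (huv : u ≠ v) (G G' : SimpleGraph V) (ψ : ℕ → ℝ) :
    ψ (deg (graftStar v G G') u) - ψ (deg G u) =
      adjInd G v u * (1 - adjInd G' v u) * (ψ (deg G u - 1) - ψ (deg G u)) +
      (1 - adjInd G v u) * adjInd G' v u * (ψ (deg G u + 1) - ψ (deg G u)) := by
  have h := deg_graftStar_of_ne huv G G'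
  by_cases h1 : G.Adj v u <;> by_cases h2 : G'.Adj v u
  · have e1 : adjInd G v u = 1 := by simp [adjInd, h1]
    have e2 : adjInd G' v u = 1 := by simp [adjInd, h2]
    rw [e1, e2] at h ⊢
    have : deg (graftStar v G G') u = deg G u := by
      have h' : (deg (graftStar v G G') u : ℝ) = deg G u := by linarith
      exact_mod_cast h'
    rw [this]; ring
  · have e1 : adjInd G v u = 1 := by simp [adjInd, h1]
    have e2 : adjInd G' v u = 0 := by simp [adjInd, h2]
    rw [e1, e2] at h ⊢
    have : deg (graftStar v G G') u + 1 = deg G u := by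
      have h' : (deg (graftStar v G G') u : ℝ) + 1 = deg G u := by linarith
      exact_mod_cast h'
    rw [← this, Nat.add_sub_cancel]; ring
  · have e1 : adjInd G v u = 0 := by simp [adjInd, h1]
    have e2 : adjInd G' v u = 1 := by simp [adjInd, h2]
    rw [e1, e2] at h ⊢
    have : deg (graftStar v G G') u = deg G u + 1 := by
      have h' : (deg (graftStar v G G') u : ℝ) = deg G u + 1 := by linarith
      exact_mod_cast h'
    rw [this]; ring
  · have e1 : adjInd G v u = 0 := by simp [adjInd, h1]
    have e2 : adjInd G' v u = 0 := by simp [adjInd, h2]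
    rw [e1, e2] at h ⊢
    have : deg (graftStar v G G') u = deg G u := by
      have h' : (deg (graftStar v G G') u : ℝ) = deg G u := by linarith
      exact_mod_cast h'
    rw [this]; ring

/-- Change variables by the weight-preserving involution on pairs of graphs that swaps the stars at
`v`; the leftover sum over the second graph is 1. -/
theorem graphMean_exchange (q : ℝ) (v : V) (φ : ℕ → ℝ) (f : SimpleGraph V → ℝ) :
    graphMean q (fun G => φ (deg G v) * f G) =
      graphMean q fun G => graphMean q fun G' => φ (deg G' v) * f (graftStar v G G') := by
  let e : SimpleGraph V × SimpleGraph V → SimpleGraph V × SimpleGraph V :=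
    fun x => (graftStar v x.1 x.2, graftStar v x.2 x.1)
  have he : Function.Involutive e := fun x =>
    Prod.ext (graftStar_graftStar v x.1 x.2) (graftStar_graftStar v x.2 x.1)
  have h := he.bijective.sum_comp (fun x : SimpleGraph V × SimpleGraph V =>
    graphWeight q x.1 * graphWeight q x.2 * (φ (deg x.2 v) * f (graftStar v x.1 x.2)))
  simp only [e, graphWeight_graftStar, graftStar_graftStar, deg_graftStar_self,
    Fintype.sum_prod_type] at h
  simp only [graphMean, Finset.mul_sum, ← mul_assoc] at h ⊢
  rw [← h]
  refine Finset.sum_congr rfl fun G _ => ?_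
  trans (∑ G' : SimpleGraph V, graphWeight q G') * (graphWeight q G * φ (deg G v) * f G)
  · rw [sum_graphWeight, one_mul]
  · rw [Finset.sum_mul]
    exact Finset.sum_congr rfl fun G' _ => by ring

/-- The sum over all vertices of a function of the degree. -/
noncomputable def degSum (ψ : ℕ → ℝ) (G : SimpleGraph V) : ℝ := ∑ v, ψ (deg G v)

theorem graphMean_degSum (q : ℝ) (ψ : ℕ → ℝ) :
    graphMean q (degSum (V := V) ψ) = Fintype.card V * binomMean q (Fintype.card V - 1) ψ := by
  change graphMean q (fun G => ∑ v, ψ (deg G v)) = _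
  simp [graphMean_sum, graphMean_deg]

/-- Since `G'` is independent of `G`, the subtracted term `f G` is exactly what centres `degSum φ`.
This is the identity that replaces a Stein equation. -/
theorem graphMean_degSum_sub_mul (q : ℝ) (φ : ℕ → ℝ) (f : SimpleGraph V → ℝ) :
    graphMean q (fun G => (degSum φ G -
        Fintype.card V * binomMean q (Fintype.card V - 1) φ) * f G) =
      graphMean q fun G => ∑ v, graphMean q fun G' =>
        φ (deg G' v) * (f (graftStar v G G') - f G) := by
  simp only [mul_sub, graphMean_sub, Finset.sum_sub_distrib]
  have h : ∀ G : SimpleGraph V,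
      ∑ v : V, graphMean q (fun G' : SimpleGraph V => φ (deg G' v) * f G) =
      Fintype.card V * binomMean q (Fintype.card V - 1) φ * f G := by
    intro G
    simp only [mul_comm _ (f G), graphMean_const_mul, graphMean_deg, Finset.sum_const,
      Finset.card_univ, nsmul_eq_mul]
    ring
  simp only [h, sub_mul, graphMean_sub]
  congr 1
  simp only [degSum, Finset.sum_mul]
  rw [graphMean_sum, graphMean_sum]
  exact Finset.sum_congr rfl fun v _ => graphMean_exchange q v φ f

theorem sum_adjInd_erase (G : SimpleGraph V) (v : V) :
    ∑ u ∈ Finset.univ.erase v, adjInd G v u = deg G v := by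
  rw [← sum_adjInd, ← Finset.add_sum_erase _ _ (Finset.mem_univ v), adjInd_self, zero_add]

/-- The function `k ↦ φ̃ k` for which the averaged increment of `degSum ψ` is a constant plus
`degSum φ̃`. Here `m` and `κ` are the means of `φ D` and of `φ D * 1(u ~ v)`. -/
noncomputable def driftFun (N : ℕ) (m κ : ℝ) (ψ : ℕ → ℝ) (k : ℕ) : ℝ :=
  -m * ψ k + (m - κ) * (k * (ψ (k - 1) - ψ k)) + κ * ((N - k) * (ψ (k + 1) - ψ k))

/-- Closure of vertex sums. Weighted by φ(deg_{G'} v), the edge `uv` is present in `G'` with mean κ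
and absent with mean m - κ. For fixed `u`, exactly `deg G u` vertices `v` can lose the edge and `N -
deg G u` can gain it, so each `u` contributes a function of its own degree. -/
theorem sum_graphMean_increment (hV : 2 ≤ Fintype.card V) (q : ℝ) (φ ψ : ℕ → ℝ)
    (G : SimpleGraph V) {N : ℕ} (hN : Fintype.card V = N + 1) {m κ : ℝ}
    (hm : m = binomMean q N φ) (hκ : κ = binomMean q N (fun k => φ k * k) / N) :
    ∑ v, graphMean q (fun G' => φ (deg G' v) * (degSum ψ (graftStar v G G') - degSum ψ G)) =
      Fintype.card V * binomMean q N (fun k => φ k * ψ k) + degSum (driftFun N m κ ψ) G := by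
  have hN' : Fintype.card V - 1 = N := by omega
  have hN0 : (N : ℝ) ≠ 0 := by
    have : N ≠ 0 := by omega
    exact_mod_cast this
  have hcard : (Fintype.card V : ℝ) - 1 = N := by rw [hN]; push_cast; ring
  have h1 : ∀ v u : V, u ≠ v → graphMean q (fun G' => φ (deg G' v) * adjInd G' v u) = κ := by
    intro v u huv
    have := sum_graphWeight_mul_deg_mul_adjInd q huv φ
    rw [hcard, hN'] at this
    rw [hκ, ← this]
    rw [graphMean]; field_simp
  have h0 : ∀ v : V, graphMean q (fun G' => φ (deg G' v)) = m := by
    intro v; rw [graphMean_deg, hN', hm]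
  have key : ∀ v, graphMean q
      (fun G' => φ (deg G' v) * (degSum ψ (graftStar v G G') - degSum ψ G)) =
      binomMean q N (fun k => φ k * ψ k) - m * ψ (deg G v) +
      ∑ u ∈ Finset.univ.erase v,
        ((m - κ) * (ψ (deg G u - 1) - ψ (deg G u)) * adjInd G v u +
        κ * (ψ (deg G u + 1) - ψ (deg G u)) * (1 - adjInd G v u)) := by
    intro v
    have e : ∀ G' : SimpleGraph V, φ (deg G' v) * (degSum ψ (graftStar v G G') - degSum ψ G) =
        φ (deg G' v) * ψ (deg G' v) - ψ (deg G v) * φ (deg G' v) +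
        ∑ u ∈ Finset.univ.erase v,
          (adjInd G v u * (ψ (deg G u - 1) - ψ (deg G u)) *
            (φ (deg G' v) - φ (deg G' v) * adjInd G' v u) +
          (1 - adjInd G v u) * (ψ (deg G u + 1) - ψ (deg G u)) *
            (φ (deg G' v) * adjInd G' v u)) := by
      intro G'
      rw [degSum, degSum, ← Finset.sum_sub_distrib, ← Finset.add_sum_erase _ _ (Finset.mem_univ v),
        deg_graftStar_self, mul_add, Finset.mul_sum, mul_sub, mul_comm (ψ (deg G v))]
      congr 1
      refine Finset.sum_congr rfl fun u hu => ?_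
      rw [apply_deg_graftStar_of_ne (Finset.ne_of_mem_erase hu)]
      ring
    simp only [e, graphMean_add, graphMean_sub, graphMean_sum, graphMean_const_mul, h0]
    rw [graphMean_deg q v (fun k => φ k * ψ k), hN']
    congr 1
    · ring
    · refine Finset.sum_congr rfl fun u hu => ?_
      rw [h1 v u (Finset.ne_of_mem_erase hu)]
      ring
  simp only [key]
  -- Interchange the replaced vertex `v` and the affected vertex `u`, so that the adjacency
  -- indicators are summed over `v` for fixed `u`.
  rw [Finset.sum_add_distrib, Finset.sum_comm' (t' := Finset.univ)
    (s' := fun u => Finset.univ.erase u) (by simp [ne_comm])]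
  have e1 : ∀ u, ∑ v ∈ Finset.univ.erase u, adjInd G v u = deg G u := by
    intro u
    rw [← sum_adjInd_erase]
    exact Finset.sum_congr rfl fun v _ => adjInd_comm G v u
  have e2 : ∀ u, ∑ v ∈ Finset.univ.erase u, (1 - adjInd G v u) = N - deg G u := by
    intro u
    simp [Finset.sum_sub_distrib, e1, Finset.card_erase_of_mem, hN']
  simp only [Finset.sum_add_distrib, ← Finset.mul_sum, e1, e2, Finset.sum_sub_distrib,
    Finset.sum_const, Finset.card_univ, nsmul_eq_mul]
  rw [sub_add, sub_eq_add_neg, degSum]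
  congr 1
  rw [Finset.mul_sum, ← Finset.sum_add_distrib, ← Finset.sum_sub_distrib, ← Finset.sum_neg_distrib]
  refine Finset.sum_congr rfl fun u _ => ?_
  unfold driftFun
  ring

/-- The exchange identity with f = `degSum ψ`: the averaged increment is explicit, and the binomial
identities turn the means of ψ(D ± 1) into means of ψ(D) and Dψ(D). -/
theorem graphMean_degSum_mul_degSum (hV : 2 ≤ Fintype.card V) {q : ℝ} (hq0 : 0 < q) (hq1 : q < 1)
    (φ ψ : ℕ → ℝ) {N : ℕ} (hN : Fintype.card V = N + 1) :
    graphMean (V := V) q (fun G => (degSum φ G - Fintype.card V * binomMean q N φ) *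
      degSum ψ G) = Fintype.card V * (binomMean q N (fun k => φ k * ψ k) -
        binomMean q N φ * binomMean q N ψ +
        binomMean q N (fun k => φ k * (k - N * q)) * binomMean q N (fun k => ψ k * (k - N * q)) /
          (N * q * (1 - q))) := by
  have hN' : Fintype.card V - 1 = N := by omega
  have hN0 : (N : ℝ) ≠ 0 := by
    have : N ≠ 0 := by omega
    exact_mod_cast this
  have h := graphMean_degSum_sub_mul (V := V) q φ (degSum ψ)
  rw [hN'] at h
  rw [h]
  simp only [sum_graphMean_increment hV q φ ψ _ hN rfl rfl, graphMean_add, graphMean_const]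
  rw [show graphMean q (fun G : SimpleGraph V => degSum (driftFun N (binomMean q N φ)
    (binomMean q N (fun k => φ k * k) / N) ψ) G) = _ from graphMean_degSum q _, hN']
  have e : ∀ χ : ℕ → ℝ, binomMean q N (fun k => χ k * (k - N * q)) =
      binomMean q N (fun k => χ k * k) - N * q * binomMean q N χ := by
    intro χ
    rw [← binomMean_const_mul, ← binomMean_sub]
    exact congrArg _ (funext fun k => by ring)
  have hp := binomMean_mul_pred q N ψ
  have hs := binomMean_mul_succ q N ψ
  have c : binomMean q N (fun k => ψ k * k) = binomMean q N (fun k => k * ψ k) :=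
    congrArg _ (funext fun k => by ring)
  have d : binomMean q N (fun k => (N - k) * ψ k) =
      N * binomMean q N ψ - binomMean q N (fun k => k * ψ k) := by
    rw [← binomMean_const_mul, ← binomMean_sub]
    exact congrArg _ (funext fun k => by ring)
  rw [e, e, c]
  unfold driftFun
  simp only [binomMean_add, binomMean_const_mul, mul_sub, binomMean_sub, d]
  have hq1' : (1 - q) ≠ 0 := by linarith
  have hp' := (eq_div_iff hq1').2 ((mul_comm _ _).trans hp)
  have hs' := (eq_div_iff hq0.ne').2 ((mul_comm _ _).trans hs)
  rw [hp', hs', ← mul_sub ((N : ℝ) * q) 1 q]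
  field_simp
  ring

end Exchange

/-! ### Variance and increment estimates -/

section Moments

variable {V : Type*} [Fintype V] [DecidableEq V]

/-- In the exact covariance with φ = ψ = χ, Cauchy–Schwarz and Var D = Nq(1 - q) bound the last term
by E χ(D)². With the leading E χ(D)² this accounts for the factor 2. -/
theorem graphMean_sq_degSum_sub_le (hV : 2 ≤ Fintype.card V) {q : ℝ} (hq0 : 0 < q) (hq1 : q < 1)
    (χ : ℕ → ℝ) {N : ℕ} (hN : Fintype.card V = N + 1) :
    graphMean (V := V) q (fun G => (degSum χ G - Fintype.card V * binomMean q N χ) ^ 2) ≤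
      2 * Fintype.card V * binomMean q N (fun k => χ k ^ 2) := by
  have hN' : Fintype.card V - 1 = N := by omega
  have hN0 : 0 < (N : ℝ) := by
    have : 0 < N := by omega
    exact_mod_cast this
  have e : graphMean (V := V) q
      (fun G => (degSum χ G - Fintype.card V * binomMean q N χ) ^ 2) =
      graphMean (V := V) q (fun G => (degSum χ G - Fintype.card V * binomMean q N χ) *
        degSum χ G) := by
    have h0 : graphMean (V := V) q (fun G => Fintype.card V * binomMean q N χ *
        (degSum χ G - Fintype.card V * binomMean q N χ)) = 0 := by
      rw [graphMean_const_mul, graphMean_sub, graphMean_const,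
        show graphMean q (fun G : SimpleGraph V => degSum χ G) = _ from graphMean_degSum q χ, hN',
        sub_self, mul_zero]
    rw [← sub_zero (graphMean q fun G => _ * degSum χ G), ← h0, ← graphMean_sub]
    exact congrArg _ (funext fun G => by ring)
  rw [e, graphMean_degSum_mul_degSum hV hq0 hq1 χ χ hN]
  have hcs := binomMean_mul_sq_le hq0.le hq1.le N χ (fun k => k - N * q)
  rw [binomMean_sub_sq] at hcs
  have hpos : 0 < N * q * (1 - q) := mul_pos (mul_pos hN0 hq0) (by linarith)
  have h1 : binomMean q N (fun k => χ k * (k - N * q)) *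
      binomMean q N (fun k => χ k * (k - N * q)) / (N * q * (1 - q)) ≤
      binomMean q N (fun k => χ k ^ 2) := by
    rw [div_le_iff₀ hpos, ← sq]; exact hcs
  have h2 : binomMean q N (fun k => χ k * χ k) = binomMean q N (fun k => χ k ^ 2) :=
    congrArg _ (funext fun k => by ring)
  have h3 := mul_self_nonneg (binomMean q N χ)
  rw [h2]
  refine (mul_le_mul_of_nonneg_left (?_ : _ ≤ 2 * binomMean q N fun k => χ k ^ 2)
    (Nat.cast_nonneg _)).trans (le_of_eq (by ring))
  linarith

theorem graphMean_abs_le_sqrt {q : ℝ} (h0 : 0 ≤ q) (h1 : q ≤ 1) (f : SimpleGraph V → ℝ) :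
    graphMean q (fun G => |f G|) ≤ √(graphMean q fun G => f G ^ 2) := by
  refine Real.le_sqrt_of_sq_le ?_
  have h := Finset.sum_mul_sq_le_sq_mul_sq (Finset.univ : Finset (SimpleGraph V))
    (fun G => √(graphWeight q G)) (fun G => √(graphWeight q G) * |f G|)
  have e : ∀ G : SimpleGraph V, √(graphWeight q G) ^ 2 = graphWeight q G :=
    fun G => Real.sq_sqrt (graphWeight_nonneg h0 h1 G)
  simp only [← mul_assoc, ← sq, mul_pow, e, sum_graphWeight, one_mul, sq_abs] at h
  exact h

theorem abs_driftFun_le {N : ℕ} {m κ : ℝ} (hκ : 0 ≤ κ) (hκm : κ ≤ m) {ψ : ℕ → ℝ}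
    (h0 : ∀ k, 0 ≤ ψ k) (h1 : ∀ k, ψ k ≤ 1) {k : ℕ} (hk : k ≤ N) :
    |driftFun N m κ ψ k| ≤ m * (1 + k) + κ * N := by
  have hd : ∀ a b, |ψ a - ψ b| ≤ 1 := fun a b =>
    abs_le.2 ⟨by linarith [h0 a, h1 b], by linarith [h1 a, h0 b]⟩
  have hk' : (k : ℝ) ≤ N := by exact_mod_cast hk
  have hk0 : (0 : ℝ) ≤ k := Nat.cast_nonneg k
  have a1 : |-m * ψ k| ≤ m := by
    rw [abs_mul, abs_neg, abs_of_nonneg (hκ.trans hκm), abs_of_nonneg (h0 k)]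
    exact mul_le_of_le_one_right (hκ.trans hκm) (h1 k)
  have a2 : |(m - κ) * (k * (ψ (k - 1) - ψ k))| ≤ m * k := by
    rw [abs_mul, abs_mul, abs_of_nonneg (sub_nonneg.2 hκm), abs_of_nonneg hk0]
    refine mul_le_mul (by linarith) ?_ (by positivity) (hκ.trans hκm)
    exact mul_le_of_le_one_right hk0 (hd _ _)
  have a3 : |κ * ((N - k) * (ψ (k + 1) - ψ k))| ≤ κ * N := by
    rw [abs_mul, abs_mul, abs_of_nonneg hκ, abs_of_nonneg (sub_nonneg.2 hk')]
    refine mul_le_mul_of_nonneg_left ?_ hκ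
    exact (mul_le_of_le_one_right (sub_nonneg.2 hk') (hd _ _)).trans (by linarith)
  unfold driftFun
  calc _ ≤ |-m * ψ k| + |(m - κ) * (k * (ψ (k - 1) - ψ k))| +
        |κ * ((N - k) * (ψ (k + 1) - ψ k))| := abs_add_three _ _ _
    _ ≤ _ := by linarith

theorem binomMean_sq_add_le {q : ℝ} (h0 : 0 ≤ q) (N : ℕ) {a : ℝ} (ha : 1 ≤ a) :
    binomMean q N (fun k => (a + k) ^ 2) ≤ 2 * (a + N * q) ^ 2 := by
  have hc : 0 ≤ N * q := by positivity
  have e : binomMean q N (fun k => (a + k) ^ 2) = (a + N * q) ^ 2 + N * q * (1 - q) := by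
    rw [← binomMean_sub_sq]
    have : (fun k : ℕ => (a + k) ^ 2) = fun k : ℕ =>
        ((a + N * q) ^ 2 - 2 * (a + N * q) * (N * q)) * 1
        + 2 * (a + N * q) * k + (k - N * q) ^ 2 := by ext k; ring
    rw [this, binomMean_add, binomMean_add, binomMean_const_mul, binomMean_const_mul,
      binomMean_id, binomMean_one]
    ring
  rw [e]
  nlinarith [mul_nonneg hc h0, mul_nonneg hc hc, mul_nonneg hc (sub_nonneg.2 ha)]

/-- Only `v` and its old and new neighbours can change degree, each moving the sum by at most 1. -/
theorem abs_degSum_graftStar_sub_le {ψ : ℕ → ℝ} (h0 : ∀ k, 0 ≤ ψ k) (h1 : ∀ k, ψ k ≤ 1)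
    (v : V) (G G' : SimpleGraph V) :
    |degSum ψ (graftStar v G G') - degSum ψ G| ≤ 1 + deg G v + deg G' v := by
  have hd : ∀ a b, |ψ a - ψ b| ≤ 1 := fun a b =>
    abs_le.2 ⟨by linarith [h0 a, h1 b], by linarith [h1 a, h0 b]⟩
  have h01 : ∀ (H : SimpleGraph V) (u w : V), adjInd H u w = 0 ∨ adjInd H u w = 1 := by
    intro H u w
    by_cases h : H.Adj u w
    · right; simp [adjInd, h]
    · left; simp [adjInd, h]
  rw [degSum, degSum, ← Finset.sum_sub_distrib, ← Finset.add_sum_erase _ _ (Finset.mem_univ v),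
    ← sum_adjInd_erase, ← sum_adjInd_erase, add_assoc, ← Finset.sum_add_distrib]
  refine (abs_add_le _ _).trans (add_le_add (hd _ _) ((Finset.abs_sum_le_sum_abs _ _).trans ?_))
  refine Finset.sum_le_sum fun u hu => ?_
  rw [apply_deg_graftStar_of_ne (Finset.ne_of_mem_erase hu)]
  rcases h01 G v u with h | h <;> rcases h01 G' v u with h' | h' <;> rw [h, h'] <;> norm_num
  · exact hd _ _
  · exact hd _ _

end Moments

/-! ### Mean, covariance and positive definiteness for the degree counts -/

section Model

/-- The indicator function of `d`. -/
def indFun (d k : ℕ) : ℝ := if k = d then 1 else 0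

theorem indFun_nonneg (d k : ℕ) : 0 ≤ indFun d k := by unfold indFun; split_ifs <;> norm_num

theorem indFun_le_one (d k : ℕ) : indFun d k ≤ 1 := by unfold indFun; split_ifs <;> norm_num

theorem binomMean_indFun_mul (q : ℝ) (N d : ℕ) (f : ℕ → ℝ) :
    binomMean q N (fun k => indFun d k * f k) = binomProb q N d * f d := by
  simp only [binomMean, indFun, ite_mul, one_mul, zero_mul, mul_ite, mul_zero]
  rw [Finset.sum_ite_eq']
  split_ifs with h
  · rfl
  · have : N < d := by simpa using h
    simp [binomProb, Nat.choose_eq_zero_of_lt this]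

theorem binomMean_indFun (q : ℝ) (N d : ℕ) : binomMean q N (indFun d) = binomProb q N d := by
  simpa using binomMean_indFun_mul q N d (fun _ => 1)

/-- Because the `d i` are distinct, their indicators sum to at most 1. This keeps sums over the
coordinates bounded independently of `p`. -/
theorem sum_binomProb_mul_le {q : ℝ} (h0 : 0 ≤ q) (h1 : q ≤ 1) (N : ℕ) {p : ℕ} {d : Fin p → ℕ}
    (hd : Function.Injective d) {g : ℕ → ℝ} (hg : ∀ k, 0 ≤ g k) :
    ∑ i, binomProb q N (d i) * g (d i) ≤ binomMean q N g := by
  simp only [← binomMean_indFun_mul]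
  simp only [binomMean]
  rw [Finset.sum_comm]
  refine Finset.sum_le_sum fun k _ => ?_
  rw [← Finset.mul_sum, ← Finset.sum_mul]
  refine mul_le_mul_of_nonneg_left (mul_le_of_le_one_left (hg k) ?_) (binomProb_nonneg h0 h1 N k)
  by_cases hk : ∃ i, d i = k
  · obtain ⟨i, rfl⟩ := hk
    simp only [indFun]
    rw [Finset.sum_eq_single i]
    · simp
    · intro j _ hj; rw [if_neg fun h => hj (hd h.symm)]
    · simp
  · simp only [indFun]
    rw [Finset.sum_eq_zero]
    · norm_num
    · intro i _; rw [if_neg fun h => hk ⟨i, h.symm⟩]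

theorem degreeCount_eq_degSum {n p : ℕ} (d : Fin p → ℕ) (G : SimpleGraph (Fin n)) (i : Fin p) :
    degreeCount d G i = degSum (indFun (d i)) G := by
  simp only [degreeCount, degSum, indFun]
  rw [Finset.sum_boole]
  rfl

variable {n p : ℕ} {c : ℝ} {d : Fin p → ℕ}

theorem two_le_of_lt (hc : 0 < c) (hcn : c < (n : ℝ) - 1) : 2 ≤ n := by
  have : (1 : ℝ) < n := by linarith
  exact_mod_cast this

theorem cast_pred (hc : 0 < c) (hcn : c < (n : ℝ) - 1) : ((n - 1 : ℕ) : ℝ) = (n : ℝ) - 1 := by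
  have := two_le_of_lt hc hcn
  push_cast [Nat.cast_sub (show 1 ≤ n by omega)]
  ring

theorem edgeProb_coe (hc : 0 < c) (hcn : c < (n : ℝ) - 1) :
    (edgeProb n c : ℝ) = c / ((n : ℝ) - 1) := by
  have h : (0 : ℝ) < n - 1 := hc.trans hcn
  rw [edgeProb, Set.projIcc_of_mem zero_le_one
    (⟨by positivity, (div_le_one h).2 hcn.le⟩ : c / ((n : ℝ) - 1) ∈ Set.Icc 0 1)]

theorem integral_graphLaw (hc : 0 < c) (hcn : c < (n : ℝ) - 1) (f : SimpleGraph (Fin n) → ℝ) :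
    ∫ G, f G ∂(graphLaw n c) = graphMean (c / ((n : ℝ) - 1)) f := by
  rw [graphLaw, integral_binomialRandom, edgeProb_coe hc hcn]
  rfl

theorem beta_eq (n : ℕ) (c : ℝ) (d : Fin p → ℕ) (i : Fin p) :
    beta n c d i = binomProb (c / ((n : ℝ) - 1)) (n - 1) (d i) := rfl

theorem meanVec_eq (hc : 0 < c) (hcn : c < (n : ℝ) - 1) (i : Fin p) :
    meanVec n c d i = n * beta n c d i := by
  rw [meanVec, integral_graphLaw hc hcn]
  simp only [degreeCount_eq_degSum]
  rw [show graphMean (c / ((n : ℝ) - 1)) (fun G : SimpleGraph (Fin n) => degSum (indFun (d i)) G) =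
    _ from graphMean_degSum _ _, Fintype.card_fin, binomMean_indFun, beta_eq]

theorem covMatrix_eq_graphMean (hc : 0 < c) (hcn : c < (n : ℝ) - 1) (i j : Fin p) :
    covMatrix n c d i j = graphMean (c / ((n : ℝ) - 1)) fun G : SimpleGraph (Fin n) =>
      (degreeCount d G i - meanVec n c d i) * (degreeCount d G j - meanVec n c d j) := by
  rw [covMatrix, Matrix.of_apply, covariance, integral_graphLaw hc hcn]
  rfl

theorem covMatrix_eq_graphMean' (hc : 0 < c) (hcn : c < (n : ℝ) - 1) (i j : Fin p) :
    covMatrix n c d i j = graphMean (c / ((n : ℝ) - 1)) fun G : SimpleGraph (Fin n) =>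
      (degreeCount d G i - meanVec n c d i) * degreeCount d G j := by
  have h : graphMean (c / ((n : ℝ) - 1)) (fun G : SimpleGraph (Fin n) =>
      meanVec n c d j * (degreeCount d G i - meanVec n c d i)) = 0 := by
    rw [graphMean_const_mul, graphMean_sub, graphMean_const, ← integral_graphLaw hc hcn,
      ← meanVec, sub_self, mul_zero]
  rw [covMatrix_eq_graphMean hc hcn, ← sub_zero (graphMean _ fun G => _ * degreeCount d G j),
    ← h, ← graphMean_sub]
  exact congrArg _ (funext fun G => by ring)

theorem covMatrix_eq (hc : 0 < c) (hcn : c < (n : ℝ) - 1) (hd : Function.Injective d)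
    (i j : Fin p) :
    covMatrix n c d i j = n * beta n c d i * beta n c d j *
            (((d i : ℝ) - c) * ((d j : ℝ) - c) / (c * (1 - c / ((n : ℝ) - 1))) - 1) +
          (if i = j then 1 else 0) * (n * beta n c d i) := by
  have hn := two_le_of_lt hc hcn
  have hN := cast_pred hc hcn
  have h1 : (0 : ℝ) < n - 1 := hc.trans hcn
  have hNq : ((n - 1 : ℕ) : ℝ) * (c / ((n : ℝ) - 1)) = c := by rw [hN]; field_simp
  have h := graphMean_degSum_mul_degSum (V := Fin n) (by simpa using hn)
    (q := c / ((n : ℝ) - 1)) (by positivity) ((div_lt_one h1).2 hcn) (indFun (d i)) (indFun (d j))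
    (N := n - 1) (by simp; omega)
  rw [covMatrix_eq_graphMean' hc hcn]
  simp only [degreeCount_eq_degSum, meanVec_eq hc hcn]
  simp only [binomMean_indFun_mul, binomMean_indFun, ← beta_eq, Fintype.card_fin, hNq] at h
  rw [h]
  have e : indFun (d j) (d i) = if i = j then 1 else 0 := by
    simp [indFun, hd.eq_iff]
  rw [e]
  ring

theorem dotProduct_covMatrix_mulVec (hc : 0 < c) (hcn : c < (n : ℝ) - 1)
    (hd : Function.Injective d) (x : Fin p → ℝ) :
    x ⬝ᵥ (covMatrix n c d).mulVec x =
      n * (∑ i, beta n c d i * x i ^ 2 - (∑ i, beta n c d i * x i) ^ 2 +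
        (∑ i, beta n c d i * (d i - c) * x i) ^ 2 / (c * (1 - c / ((n : ℝ) - 1)))) := by
  simp only [dotProduct, Matrix.mulVec, covMatrix_eq hc hcn hd, add_mul, Finset.sum_add_distrib,
    ite_mul, one_mul, zero_mul, Finset.sum_ite_eq, Finset.mem_univ, if_true, mul_add]
  rw [sq (∑ i, beta n c d i * x i), sq (∑ i, beta n c d i * (d i - c) * x i), Finset.sum_mul_sum,
    Finset.sum_mul_sum]
  have h1 : ∑ i, x i * ∑ j, n * beta n c d i * beta n c d j *
      (((d i : ℝ) - c) * ((d j : ℝ) - c) / (c * (1 - c / ((n : ℝ) - 1))) - 1) * x j =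
      n * ((∑ i, ∑ j, beta n c d i * (d i - c) * x i * (beta n c d j * (d j - c) * x j)) /
        (c * (1 - c / ((n : ℝ) - 1)))) -
      n * ∑ i, ∑ j, beta n c d i * x i * (beta n c d j * x j) := by
    simp only [Finset.sum_div, Finset.mul_sum, ← Finset.sum_sub_distrib]
    exact Finset.sum_congr rfl fun i _ => Finset.sum_congr rfl fun j _ => by ring
  have h2 : ∑ i, x i * (n * beta n c d i * x i) = n * ∑ i, beta n c d i * x i ^ 2 := by
    simp only [Finset.mul_sum]
    exact Finset.sum_congr rfl fun i _ => by ring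
  rw [h1]
  linear_combination h2

/-- The degree-correlation term is a nonnegative square and is dropped; Cauchy–Schwarz gives (∑ βx)²
≤ (∑ β)(∑ βx²) for the negative term. -/
theorem quadratic_lower_bound (hc : 0 < c) (hcn : c < (n : ℝ) - 1)
    (hd : Function.Injective d) (hβ : ∀ i, 0 < beta n c d i) (x : Fin p → ℝ) :
    n * (1 - ∑ i, beta n c d i) * ∑ i, beta n c d i * x i ^ 2 ≤
      x ⬝ᵥ (covMatrix n c d).mulVec x := by
  rw [dotProduct_covMatrix_mulVec hc hcn hd, mul_assoc]
  refine mul_le_mul_of_nonneg_left ?_ (Nat.cast_nonneg n)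
  have h1 : (0 : ℝ) < n - 1 := hc.trans hcn
  have h2 : 0 < 1 - c / ((n : ℝ) - 1) := sub_pos.2 ((div_lt_one h1).2 hcn)
  have h3 : 0 ≤ (∑ i, beta n c d i * (d i - c) * x i) ^ 2 / (c * (1 - c / ((n : ℝ) - 1))) := by
    positivity
  have h4 := Finset.sum_mul_sq_le_sq_mul_sq Finset.univ (fun i => √(beta n c d i))
    (fun i => √(beta n c d i) * x i)
  have e : ∀ i, √(beta n c d i) ^ 2 = beta n c d i := fun i => Real.sq_sqrt (hβ i).le
  simp only [← mul_assoc, ← sq, mul_pow, e] at h4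
  linarith

theorem covMatrix_posDef (hc : 0 < c) (hcn : c < (n : ℝ) - 1)
    (hd : Function.Injective d) (hβ : ∀ i, 0 < beta n c d i) (hs : ∑ i, beta n c d i < 1) :
    (covMatrix n c d).PosDef := by
  refine Matrix.PosDef.of_dotProduct_mulVec_pos ?_ ?_
  · ext i j
    simp only [Matrix.conjTranspose_apply, star_trivial, covMatrix_eq_graphMean hc hcn]
    exact congrArg _ (funext fun G => by ring)
  · intro x hx
    refine lt_of_lt_of_le ?_ (quadratic_lower_bound hc hcn hd hβ x)
    have hn := two_le_of_lt hc hcn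
    obtain ⟨i, hi⟩ := Function.ne_iff.1 hx
    have : 0 < ∑ i, beta n c d i * x i ^ 2 :=
      Finset.sum_pos' (fun j _ => mul_nonneg (hβ j).le (sq_nonneg _))
        ⟨i, Finset.mem_univ i, mul_pos (hβ i) (by simpa using sq_pos_of_ne_zero hi)⟩
    have hn' : (0 : ℝ) < n := by exact_mod_cast (show 0 < n by omega)
    exact mul_pos (mul_pos hn' (by linarith)) this

theorem quadratic_lower_bound_bigB (hp : 1 ≤ p) (hc : 0 < c) (hcn : c < (n : ℝ) - 1)
    (hd : Function.Injective d) (hβ : ∀ i, 0 < beta n c d i) (hs : ∑ i, beta n c d i < 1) :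
    0 < bigB n c d ∧ ∀ x : Fin p → ℝ,
      n / bigB n c d * ∑ i, x i ^ 2 ≤ x ⬝ᵥ (covMatrix n c d).mulVec x := by
  have : Nonempty (Fin p) := ⟨⟨0, hp⟩⟩
  have hmin : 0 < ⨅ i, beta n c d i := by
    obtain ⟨i, hi⟩ := exists_eq_ciInf_of_finite (f := beta n c d)
    rw [← hi]; exact hβ i
  refine ⟨by unfold bigB; exact one_div_pos.2 (mul_pos hmin (by linarith)), fun x => ?_⟩
  refine le_trans ?_ (quadratic_lower_bound hc hcn hd hβ x)
  rw [bigB, div_div_eq_mul_div, div_one, mul_comm (⨅ i, beta n c d i), ← mul_assoc, mul_assoc]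
  refine mul_le_mul_of_nonneg_left ?_ (mul_nonneg (Nat.cast_nonneg n) (by linarith))
  rw [Finset.mul_sum]
  exact Finset.sum_le_sum fun i _ => mul_le_mul_of_nonneg_right
    (ciInf_le (Finite.bddBelow_range _) i) (sq_nonneg _)

end Model

/-! ### The inverse square root of the covariance matrix -/

section InvSqrt

variable {p : ℕ}

open scoped MatrixOrder in
theorem invSqrt_mul_mul_transpose {S : Matrix (Fin p) (Fin p) ℝ} (hS : S.PosDef) :
    invSqrt S * S * (invSqrt S).transpose = 1 := by
  have h0 : 0 ≤ S := hS.posSemidef.nonneg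
  have hsq : CFC.sqrt S * CFC.sqrt S = S := CFC.sqrt_mul_sqrt_self S h0
  have hdet : IsUnit (CFC.sqrt S).det := by
    have h1 := hS.det_pos
    rw [← hsq, Matrix.det_mul] at h1
    exact isUnit_iff_ne_zero.2 fun h => by simp [h] at h1
  have hT : (CFC.sqrt S).transpose = CFC.sqrt S := by
    have := (CFC.sqrt_nonneg S).isSelfAdjoint
    rw [IsSelfAdjoint, Matrix.star_eq_conjTranspose, Matrix.conjTranspose_eq_transpose_of_trivial]
      at this
    exact this
  rw [invSqrt, Matrix.transpose_nonsing_inv, hT]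
  nth_rewrite 2 [← hsq]
  rw [← mul_assoc, Matrix.nonsing_inv_mul _ hdet, one_mul, Matrix.mul_nonsing_inv _ hdet]

/-- Each row x of A = S^(-1/2) satisfies x·Sx = 1, a diagonal entry of A S Aᵀ = 1, so coercivity
bounds |x|² by 1/μ. -/
theorem abs_invSqrt_apply_le {S : Matrix (Fin p) (Fin p) ℝ} (hS : S.PosDef) {μ : ℝ} (hμ : 0 < μ)
    (h : ∀ x : Fin p → ℝ, μ * ∑ i, x i ^ 2 ≤ x ⬝ᵥ S.mulVec x) (i j : Fin p) :
    |invSqrt S i j| ≤ √(1 / μ) := by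
  refine Real.abs_le_sqrt ?_
  have h1 := h (invSqrt S i)
  have h2 : invSqrt S i ⬝ᵥ S.mulVec (invSqrt S i) = 1 := by
    have := congrFun (congrFun (invSqrt_mul_mul_transpose hS) i) i
    rw [Matrix.one_apply_eq, Matrix.mul_assoc] at this
    exact this
  rw [h2] at h1
  rw [le_div_iff₀ hμ, mul_comm]
  refine le_trans (mul_le_mul_of_nonneg_left ?_ hμ.le) h1
  exact Finset.single_le_sum (f := fun j => invSqrt S i j ^ 2) (fun _ _ => sq_nonneg _)
    (Finset.mem_univ j)

end InvSqrt

/-! ### Taylor estimates from coordinate derivatives alone -/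

section Taylor

variable {p : ℕ} {f : (Fin p → ℝ) → ℝ} {g : Fin p → (Fin p → ℝ) → ℝ}

theorem exists_lineDeriv_mean_value (h : ∀ j x, HasLineDerivAt ℝ f (g j x) x (Pi.single j 1))
    (a : Fin p) (y : Fin p → ℝ) (r : ℝ) :
    ∃ t ∈ Set.Ioo (0 : ℝ) 1, f (y + r • Pi.single a 1) - f y =
      r * g a (y + (t * r) • Pi.single a 1) := by
  have hd : ∀ t : ℝ, HasDerivAt (fun t : ℝ => f (y + (t * r) • Pi.single a (1 : ℝ)))
      (g a (y + (t * r) • Pi.single a 1) * r) t := by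
    intro t
    have h1 : HasDerivAt (fun s : ℝ => f (y + (t * r) • Pi.single a (1 : ℝ) +
        s • Pi.single a (1 : ℝ))) (g a (y + (t * r) • Pi.single a 1)) (t * r - t * r) := by
      rw [sub_self]; exact h a (y + (t * r) • Pi.single a 1)
    have h2 := h1.comp_sub_const (t * r) (t * r)
    have h3 : HasDerivAt (fun t : ℝ => t * r) r t := by simpa using (hasDerivAt_id t).mul_const r
    have h4 := HasDerivAt.comp t h2 h3
    refine h4.congr_of_eventuallyEq (Eventually.of_forall fun s => ?_)
    simp only [Function.comp]
    congr 1
    rw [add_assoc, ← add_smul]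
    congr 2
    ring
  obtain ⟨t, ht, e⟩ := exists_hasDerivAt_eq_slope _ _ zero_lt_one
    (fun t _ => (hd t).continuousAt.continuousWithinAt) (fun t _ => hd t)
  refine ⟨t, ht, ?_⟩
  simp only [one_mul, zero_mul, zero_smul, add_zero, sub_zero, div_one] at e
  rw [← e, mul_comm]

/-- Only partial derivatives are available, so the increment is made one coordinate at a time, by
induction on the set of coordinates already moved. The intermediate points stay in the box of
half-widths `|δ k|` around `x`. -/
theorem exists_coordinatewise_mean_value
    (h : ∀ j x, HasLineDerivAt ℝ f (g j x) x (Pi.single j 1)) (x δ : Fin p → ℝ) :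
    ∃ ξ : Fin p → Fin p → ℝ, (∀ j k, |ξ j k - x k| ≤ |δ k|) ∧
      f (x + δ) - f x = ∑ j, δ j * g j (ξ j) := by
  suffices H : ∀ s : Finset (Fin p), ∃ ξ : Fin p → Fin p → ℝ,
      (∀ j k, |ξ j k - x k| ≤ |δ k|) ∧
      f (x + fun k => if k ∈ s then δ k else 0) - f x = ∑ j ∈ s, δ j * g j (ξ j) by
    simpa using H Finset.univ
  intro s
  induction s using Finset.induction_on with
  | empty => exact ⟨fun _ => x, by simp, by simp [show (fun _ : Fin p => (0 : ℝ)) = 0 from rfl]⟩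
  | insert a s ha ih =>
    obtain ⟨ξ, hξ, e⟩ := ih
    obtain ⟨t, ht, et⟩ := exists_lineDeriv_mean_value h a
      (x + fun k => if k ∈ s then δ k else 0) (δ a)
    refine ⟨Function.update ξ a ((x + fun k => if k ∈ s then δ k else 0) +
      (t * δ a) • Pi.single a 1), ?_, ?_⟩
    · intro j k
      by_cases hj : j = a
      · subst hj
        rw [Function.update_self]
        by_cases hk : k = j
        · subst hk
          simp only [Pi.add_apply, Pi.smul_apply, Pi.single_eq_same, ha, if_false, smul_eq_mul,
            mul_one, add_zero, add_sub_cancel_left, abs_mul, abs_of_pos ht.1]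
          exact mul_le_of_le_one_left (abs_nonneg _) ht.2.le
        · by_cases hks : k ∈ s <;> simp [hk, hks]
      · rw [Function.update_of_ne hj]; exact hξ j k
    · rw [Finset.sum_insert ha, Function.update_self]
      rw [Finset.sum_congr rfl (g := fun j => δ j * g j (ξ j)) fun j hj => by
        rw [Function.update_of_ne (fun h : j = a => ha (h ▸ hj))], ← e, ← et]
      have : (x + fun k => if k ∈ insert a s then δ k else 0) =
          (x + fun k => if k ∈ s then δ k else 0) + δ a • Pi.single a (1 : ℝ) := by
        ext k
        by_cases hk : k = a
        · subst hk; simp [ha]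
        · by_cases hks : k ∈ s <;> simp [hk, hks]
      rw [this]
      ring

theorem abs_sub_le_of_abs_lineDeriv_le
    (h : ∀ j x, HasLineDerivAt ℝ f (g j x) x (Pi.single j 1)) {C : ℝ} (hC : ∀ j x, |g j x| ≤ C)
    (x y : Fin p → ℝ) : |f y - f x| ≤ C * ∑ k, |y k - x k| := by
  obtain ⟨ξ, -, e⟩ := exists_coordinatewise_mean_value h x (y - x)
  rw [add_sub_cancel] at e
  rw [e, Finset.mul_sum]
  refine (Finset.abs_sum_le_sum_abs _ _).trans (Finset.sum_le_sum fun j _ => ?_)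
  rw [abs_mul, mul_comm, Pi.sub_apply]
  exact mul_le_mul_of_nonneg_right (hC _ _) (abs_nonneg _)

theorem abs_taylor_remainder_le
    (h : ∀ j x, HasLineDerivAt ℝ f (g j x) x (Pi.single j 1)) {L : ℝ} (hL0 : 0 ≤ L)
    (hL : ∀ j x y, |g j y - g j x| ≤ L * ∑ k, |y k - x k|) (x δ : Fin p → ℝ) :
    |f (x + δ) - f x - ∑ j, δ j * g j x| ≤ L * (∑ k, |δ k|) ^ 2 := by
  obtain ⟨ξ, hξ, e⟩ := exists_coordinatewise_mean_value h x δ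
  rw [e, ← Finset.sum_sub_distrib, sq, ← mul_assoc, Finset.mul_sum]
  refine (Finset.abs_sum_le_sum_abs _ _).trans (Finset.sum_le_sum fun j _ => ?_)
  rw [← mul_sub, abs_mul, mul_comm]
  refine mul_le_mul_of_nonneg_right ((hL j x (ξ j)).trans ?_) (abs_nonneg _)
  exact mul_le_mul_of_nonneg_left (Finset.sum_le_sum fun k _ => hξ j k) hL0

theorem continuous_of_abs_sub_le {C : ℝ}
    (h : ∀ x y, |f y - f x| ≤ C * ∑ k, |y k - x k|) : Continuous f := by
  rw [continuous_iff_continuousAt]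
  intro x
  have h0 : Tendsto (fun y : Fin p → ℝ => C * ∑ k, |y k - x k|) (nhds x) (nhds 0) := by
    have : Continuous (fun y : Fin p → ℝ => C * ∑ k, |y k - x k|) := by fun_prop
    simpa using this.tendsto x
  rw [ContinuousAt, tendsto_iff_norm_sub_tendsto_zero]
  exact squeeze_zero (fun _ => norm_nonneg _) (fun y => h x y) h0

/-- The quadratic Taylor remainder upgrades Lipschitz partials to Fréchet differentiability, which
the chain rule along the interpolation path requires. -/
theorem hasFDerivAt_of_lineDeriv_lipschitz
    (h : ∀ j x, HasLineDerivAt ℝ f (g j x) x (Pi.single j 1)) {L : ℝ} (hL0 : 0 ≤ L)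
    (hL : ∀ j x y, |g j y - g j x| ≤ L * ∑ k, |y k - x k|) (x : Fin p → ℝ) :
    HasFDerivAt f (∑ j, g j x • ContinuousLinearMap.proj (R := ℝ) (φ := fun _ : Fin p => ℝ) j)
      x := by
  rw [hasFDerivAt_iff_isLittleO_nhds_zero]
  have h2 : (fun δ : Fin p → ℝ => f (x + δ) - f x -
      (∑ j, g j x • ContinuousLinearMap.proj (R := ℝ) (φ := fun _ : Fin p => ℝ) j) δ)
      =O[nhds 0] fun δ => ‖δ‖ ^ 2 := by
    refine Asymptotics.IsBigO.of_bound (L * p ^ 2) (Eventually.of_forall fun δ => ?_)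
    have h3 := abs_taylor_remainder_le h hL0 hL x δ
    have h4 : ∑ k, |δ k| ≤ p * ‖δ‖ := by
      calc ∑ k, |δ k| ≤ ∑ _k : Fin p, ‖δ‖ := Finset.sum_le_sum fun k _ => norm_le_pi_norm δ k
        _ = p * ‖δ‖ := by simp
    have h5 : 0 ≤ ∑ k, |δ k| := Finset.sum_nonneg fun _ _ => abs_nonneg _
    rw [Real.norm_eq_abs, norm_pow, norm_norm]
    simp only [sum_apply, smul_apply,
      ContinuousLinearMap.proj_apply, smul_eq_mul, mul_comm (g _ x)]
    refine h3.trans ?_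
    rw [mul_assoc, ← mul_pow]
    exact mul_le_mul_of_nonneg_left (pow_le_pow_left₀ h5 h4 2) hL0
  exact h2.trans_isLittleO (Asymptotics.isLittleO_norm_pow_id one_lt_two)

end Taylor

/-! ### Gaussian integration by parts -/

section Gaussian

theorem hasDerivAt_gaussianPDFReal (x : ℝ) :
    HasDerivAt (gaussianPDFReal 0 1) (-(x * gaussianPDFReal 0 1 x)) x := by
  have h1 : HasDerivAt (fun x : ℝ => -(x - 0) ^ 2 / (2 * ((1 : NNReal) : ℝ))) (-x) x := by
    have := ((hasDerivAt_id x).pow 2).neg.div_const 2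
    refine (this.congr_deriv (by simp; ring)).congr_of_eventuallyEq
      (Eventually.of_forall fun y => by simp)
  have h2 := (h1.exp).const_mul (√(2 * Real.pi * ((1 : NNReal) : ℝ)))⁻¹
  rw [gaussianPDFReal_def]
  refine h2.congr_deriv ?_
  ring

theorem integrable_id_gaussianReal : Integrable (fun x : ℝ => x) (gaussianReal 0 1) :=
  (memLp_id_gaussianReal (μ := 0) (v := 1) 1).integrable le_rfl

theorem integral_id_mul_gaussianReal {F F' : ℝ → ℝ} (h : ∀ x, HasDerivAt F (F' x) x)
    (hF' : Continuous F') {C C' : ℝ} (hC : ∀ x, |F x| ≤ C) (hC' : ∀ x, |F' x| ≤ C') :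
    ∫ x, x * F x ∂(gaussianReal 0 1) = ∫ x, F' x ∂(gaussianReal 0 1) := by
  have hFc : Continuous F := continuous_iff_continuousAt.2 fun x => (h x).continuousAt
  have hid : Integrable (fun x : ℝ => x * gaussianPDFReal 0 1 x) := by
    have := integrable_mul_exp_neg_mul_sq (b := 1 / 2) (by norm_num)
    refine (this.const_mul (√(2 * Real.pi))⁻¹).congr (Eventually.of_forall fun x => ?_)
    simp only [gaussianPDFReal_def, sub_zero, NNReal.coe_one, mul_one]
    rw [show -x ^ 2 / 2 = -(1 / 2) * x ^ 2 by ring]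
    ring
  rw [integral_gaussianReal_eq_integral_smul one_ne_zero,
    integral_gaussianReal_eq_integral_smul one_ne_zero]
  have hu := integral_mul_deriv_eq_deriv_mul_of_integrable (u := F) (u' := F')
    (v := gaussianPDFReal 0 1) (v' := fun x => -(x * gaussianPDFReal 0 1 x))
    (fun x _ => h x) (fun x _ => hasDerivAt_gaussianPDFReal x)
    (hid.neg.bdd_mul hFc.aestronglyMeasurable (Eventually.of_forall hC))
    ((integrable_gaussianPDFReal 0 1).bdd_mul hF'.aestronglyMeasurable (Eventually.of_forall hC'))
    ((integrable_gaussianPDFReal 0 1).bdd_mul hFc.aestronglyMeasurable (Eventually.of_forall hC))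
  simp only [mul_neg, integral_neg, neg_inj] at hu
  simp only [smul_eq_mul]
  calc ∫ x, gaussianPDFReal 0 1 x * (x * F x) = ∫ x, F x * (x * gaussianPDFReal 0 1 x) :=
        integral_congr_ae (Eventually.of_forall fun x => by ring)
    _ = ∫ x, F' x * gaussianPDFReal 0 1 x := hu
    _ = _ := integral_congr_ae (Eventually.of_forall fun x => by ring)

theorem integrable_eval_stdNormal {p : ℕ} (a : Fin p) :
    Integrable (fun z : Fin p → ℝ => z a) (stdNormal p) :=
  (measurePreserving_eval (fun _ : Fin p => gaussianReal 0 1) a).integrable_comp_of_integrable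
    integrable_id_gaussianReal

/-- Fubini isolates coordinate `a`; for fixed remaining coordinates it is the one-dimensional
identity, which comes from the density having derivative -x times itself. -/
theorem integral_eval_mul_stdNormal {p : ℕ} (a : Fin p) {F F' : (Fin p → ℝ) → ℝ}
    (h : ∀ x, HasLineDerivAt ℝ F (F' x) x (Pi.single a 1)) (hFc : Continuous F)
    (hF' : Continuous F') {C C' : ℝ} (hC : ∀ x, |F x| ≤ C) (hC' : ∀ x, |F' x| ≤ C') :
    ∫ z, z a * F z ∂(stdNormal p) = ∫ z, F' z ∂(stdNormal p) := by
  obtain ⟨m, rfl⟩ : ∃ m, p = m + 1 := ⟨p - 1, by have := a.pos; omega⟩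
  have hi1 : Integrable (fun z : Fin (m + 1) → ℝ => z a * F z) (stdNormal (m + 1)) :=
    (integrable_eval_stdNormal a).mul_bdd hFc.aestronglyMeasurable (Eventually.of_forall hC)
  have hi2 : Integrable F' (stdNormal (m + 1)) :=
    Integrable.of_bound hF'.aestronglyMeasurable C' (Eventually.of_forall hC')
  have mp := (measurePreserving_piFinSuccAbove (fun _ : Fin (m + 1) => gaussianReal 0 1) a).symm
  have me := (MeasurableEquiv.piFinSuccAbove (fun _ : Fin (m + 1) => ℝ) a).symm.measurableEmbedding
  rw [← mp.integrable_comp_emb me] at hi1 hi2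
  simp only [Function.comp_def] at hi1 hi2
  rw [stdNormal, ← mp.integral_comp', ← mp.integral_comp', integral_prod_symm _ hi1,
    integral_prod_symm _ hi2]
  refine integral_congr_ae (Eventually.of_forall fun y => ?_)
  simp only [MeasurableEquiv.piFinSuccAbove_symm_apply, Fin.insertNthEquiv, Equiv.coe_fn_mk,
    Fin.insertNth_apply_same]
  have hcont : Continuous fun t : ℝ => (a.insertNth t y : Fin (m + 1) → ℝ) :=
    continuous_pi fun k => by
      refine Fin.succAboveCases a ?_ (fun k => ?_) k
      · simpa using continuous_id'
      · simpa using continuous_const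
  refine integral_id_mul_gaussianReal (fun t => ?_) (hF'.comp hcont) (fun t => hC _) fun t => hC' _
  have h1 : HasDerivAt (fun s : ℝ => F (a.insertNth t y + s • Pi.single a (1 : ℝ)))
      (F' (a.insertNth t y)) (t - t) := by
    rw [sub_self]; exact h _
  refine (h1.comp_sub_const t t).congr_of_eventuallyEq (Eventually.of_forall fun s => ?_)
  simp only
  congr 1
  ext k
  refine Fin.succAboveCases a ?_ (fun k => ?_) k <;> simp

end Gaussian

/-! ### Interpolation between the exchangeable vector and the normal vector -/

section SmartPath

variable {p : ℕ}

/-- A function `h` with bounded gradient `g₁`, bounded Hessian `g₂`, and Lipschitz Hessian. -/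
structure SmoothBounds (h : (Fin p → ℝ) → ℝ) (g₁ : Fin p → (Fin p → ℝ) → ℝ)
    (g₂ : Fin p → Fin p → (Fin p → ℝ) → ℝ) (C L₂ L₃ : ℝ) : Prop where
  grad : ∀ a x, HasLineDerivAt ℝ h (g₁ a x) x (Pi.single a 1)
  hess : ∀ a b x, HasLineDerivAt ℝ (g₁ a) (g₂ a b x) x (Pi.single b 1)
  grad_le : ∀ a x, |g₁ a x| ≤ C
  hess_le : ∀ a b x, |g₂ a b x| ≤ L₂
  hess_lip : ∀ a b x y, |g₂ a b y - g₂ a b x| ≤ L₃ * ∑ k, |y k - x k|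
  hess_nonneg : 0 ≤ L₂
  lip_nonneg : 0 ≤ L₃

/-- An exchange procedure `R` on a finite weighted space for which the moments of the centred
vector `Y` against arbitrary functions are given by increments under `R`. -/
structure Exchange {Ω T : Type*} [Fintype Ω] [Fintype T] (w : Ω → ℝ) (Y : Ω → Fin p → ℝ)
    (a : Fin p → T → ℝ) (R : T → Ω → Ω) (δ : T → Ω → ℝ) (S : Matrix (Fin p) (Fin p) ℝ)
    (e₁ e₂ : Fin p → ℝ) : Prop where
  weight_nonneg : ∀ ω, 0 ≤ w ω
  sum_weight : ∑ ω, w ω = 1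
  rate_nonneg : ∀ i τ, 0 ≤ a i τ
  exchange : ∀ i (f : Ω → ℝ),
    ∑ ω, w ω * (Y ω i * f ω) = ∑ ω, w ω * ∑ τ, a i τ * (f (R τ ω) - f ω)
  increment_le : ∀ τ ω j, |Y (R τ ω) j - Y ω j| ≤ δ τ ω
  drift_le : ∀ i j, ∑ ω, w ω * |∑ τ, a i τ * (Y (R τ ω) j - Y ω j) - S i j| ≤ e₁ i
  sq_le : ∀ i, ∑ ω, w ω * ∑ τ, a i τ * δ τ ω ^ 2 ≤ e₂ i

variable {h : (Fin p → ℝ) → ℝ} {g₁ : Fin p → (Fin p → ℝ) → ℝ}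
  {g₂ : Fin p → Fin p → (Fin p → ℝ) → ℝ} {C L₂ L₃ : ℝ}
  {Ω T : Type*} [Fintype Ω] [Fintype T] {w : Ω → ℝ} {Y : Ω → Fin p → ℝ}
  {a : Fin p → T → ℝ} {R : T → Ω → Ω} {δ : T → Ω → ℝ} {S : Matrix (Fin p) (Fin p) ℝ}
  {e₁ e₂ : Fin p → ℝ} {A : Matrix (Fin p) (Fin p) ℝ} {α : ℝ}

theorem SmoothBounds.continuous (H : SmoothBounds h g₁ g₂ C L₂ L₃) : Continuous h :=
  continuous_of_abs_sub_le (abs_sub_le_of_abs_lineDeriv_le H.grad H.grad_le)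

theorem SmoothBounds.grad_lip (H : SmoothBounds h g₁ g₂ C L₂ L₃) (b : Fin p) :
    ∀ x y, |g₁ b y - g₁ b x| ≤ L₂ * ∑ k, |y k - x k| :=
  abs_sub_le_of_abs_lineDeriv_le (H.hess b) (H.hess_le b)

theorem SmoothBounds.continuous_grad (H : SmoothBounds h g₁ g₂ C L₂ L₃) (b : Fin p) :
    Continuous (g₁ b) := continuous_of_abs_sub_le (H.grad_lip b)

theorem SmoothBounds.continuous_hess (H : SmoothBounds h g₁ g₂ C L₂ L₃) (b b' : Fin p) :
    Continuous (g₂ b b') := continuous_of_abs_sub_le (H.hess_lip b b')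

/-- The displacement `s A v` has ℓ¹ norm at most p²αD. The Taylor remainder of each `g₁ b` is thus
at most L₃(p²αD)², and summing over `b` with weights at most α gives p⁵α³L₃D². -/
theorem SmoothBounds.abs_increment_sub_le (H : SmoothBounds h g₁ g₂ C L₂ L₃)
    (hα : ∀ i j, |A i j| ≤ α) {s : ℝ} (hs : |s| ≤ 1) (i : Fin p) (u v : Fin p → ℝ) {D : ℝ}
    (hv : ∀ j, |v j| ≤ D) :
    |∑ b, A b i * g₁ b (u + s • A.mulVec v) - ∑ b, A b i * g₁ b u -
      ∑ j, v j * (s * ∑ b, ∑ b', A b i * A b' j * g₂ b b' u)| ≤ p ^ 5 * α ^ 3 * L₃ * D ^ 2 := by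
  have hα0 : 0 ≤ α := (abs_nonneg _).trans (hα i i)
  have hD0 : 0 ≤ D := (abs_nonneg _).trans (hv i)
  have e : ∑ b, A b i * g₁ b (u + s • A.mulVec v) - ∑ b, A b i * g₁ b u -
      ∑ j, v j * (s * ∑ b, ∑ b', A b i * A b' j * g₂ b b' u) =
      ∑ b, A b i * (g₁ b (u + s • A.mulVec v) - g₁ b u -
        ∑ b', (s • A.mulVec v) b' * g₂ b b' u) := by
    simp only [mul_sub, Finset.sum_sub_distrib]
    congr 1
    simp only [Pi.smul_apply, Matrix.mulVec, dotProduct, smul_eq_mul, Finset.mul_sum,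
      Finset.sum_mul]
    rw [Finset.sum_comm]
    refine Finset.sum_congr rfl fun b _ => ?_
    rw [Finset.sum_comm]
    exact Finset.sum_congr rfl fun b' _ => Finset.sum_congr rfl fun j _ => by ring
  have hAv : ∀ b, |(s • A.mulVec v) b| ≤ p * (α * D) := by
    intro b
    rw [Pi.smul_apply, smul_eq_mul, abs_mul]
    refine (mul_le_of_le_one_left (abs_nonneg _) hs).trans ?_
    change |∑ j, A b j * v j| ≤ _
    refine (Finset.abs_sum_le_sum_abs _ _).trans ?_
    refine (Finset.sum_le_sum (g := fun _ => α * D) fun j _ => ?_).trans (by simp)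
    rw [abs_mul]
    exact mul_le_mul (hα _ _) (hv _) (abs_nonneg _) hα0
  have hsum : ∑ b, |(s • A.mulVec v) b| ≤ p * (p * (α * D)) :=
    (Finset.sum_le_sum fun b _ => hAv b).trans (by simp)
  rw [e]
  refine (Finset.abs_sum_le_sum_abs _ _).trans
    ((Finset.sum_le_sum (g := fun _ => α * (L₃ * (p * (p * (α * D))) ^ 2)) fun b _ => ?_).trans
      (le_of_eq (by simp; ring)))
  rw [abs_mul]
  refine mul_le_mul (hα _ _) ?_ (abs_nonneg _) hα0
  refine (abs_taylor_remainder_le (H.hess b) H.lip_nonneg (H.hess_lip b) u _).trans ?_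
  exact mul_le_mul_of_nonneg_left
    (pow_le_pow_left₀ (Finset.sum_nonneg fun _ _ => abs_nonneg _) hsum 2) H.lip_nonneg

/-- Approximate Stein identity for X = AY at a fixed shift `z`. Exchange turns E X·∇h(sX + z) into a
mean of increments; their linear part has mean rate close to `S`, and A S Aᵀ = 1 converts `S` into
the Laplacian. The errors are the drift fluctuation `e₁` and the squared increments `e₂`. -/
theorem Exchange.abs_sum_grad_sub_hess_le (E : Exchange w Y a R δ S e₁ e₂)
    (H : SmoothBounds h g₁ g₂ C L₂ L₃) (hα : ∀ i j, |A i j| ≤ α) (hA : A * S * A.transpose = 1)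
    {s : ℝ} (hs : |s| ≤ 1) (z : Fin p → ℝ) :
    |∑ ω, w ω * (∑ b, A.mulVec (Y ω) b * g₁ b (s • A.mulVec (Y ω) + z) -
        s * ∑ b, g₂ b b (s • A.mulVec (Y ω) + z))| ≤
      p ^ 3 * α ^ 2 * L₂ * ∑ i, e₁ i + p ^ 5 * α ^ 3 * L₃ * ∑ i, e₂ i := by
  set U : Ω → Fin p → ℝ := fun ω => s • A.mulVec (Y ω) + z with hU
  set f : Fin p → Ω → ℝ := fun i ω => ∑ b, A b i * g₁ b (U ω) with hf
  set D : Fin p → Fin p → Ω → ℝ := fun i j ω => s * ∑ b, ∑ b', A b i * A b' j * g₂ b b' (U ω)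
    with hD
  have hα0 : ∀ _ : Fin p, 0 ≤ α := fun i => (abs_nonneg _).trans (hα i i)
  have t1 : ∀ ω, ∑ b, A.mulVec (Y ω) b * g₁ b (U ω) = ∑ i, Y ω i * f i ω := by
    intro ω
    simp only [hf, Matrix.mulVec, dotProduct, Finset.sum_mul, Finset.mul_sum]
    rw [Finset.sum_comm]
    exact Finset.sum_congr rfl fun i _ => Finset.sum_congr rfl fun b _ => by ring
  have t3 : ∀ ω, s * ∑ b, g₂ b b (U ω) = ∑ i, ∑ j, S i j * D i j ω := by
    intro ω
    have hA' : ∀ b b', ∑ i, ∑ j, S i j * (A b i * A b' j) = if b = b' then 1 else 0 := by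
      intro b b'
      rw [← Matrix.one_apply, ← hA, Matrix.mul_apply, Finset.sum_comm]
      refine Finset.sum_congr rfl fun j _ => ?_
      rw [Matrix.mul_apply, Finset.sum_mul]
      exact Finset.sum_congr rfl fun i _ => by rw [Matrix.transpose_apply]; ring
    calc s * ∑ b, g₂ b b (U ω)
        = s * ∑ b, ∑ b', (∑ i, ∑ j, S i j * (A b i * A b' j)) * g₂ b b' (U ω) := by
          simp [hA']
      _ = ∑ b, ∑ b', ∑ i, ∑ j, s * (S i j * (A b i * A b' j) * g₂ b b' (U ω)) := by
          simp only [Finset.mul_sum, Finset.sum_mul]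
      _ = ∑ i, ∑ j, ∑ b, ∑ b', s * (S i j * (A b i * A b' j) * g₂ b b' (U ω)) := by
          rw [Finset.sum_congr rfl fun b _ => Finset.sum_comm, Finset.sum_comm]
          refine Finset.sum_congr rfl fun i _ => ?_
          rw [Finset.sum_congr rfl fun b _ => Finset.sum_comm, Finset.sum_comm]
      _ = _ := by
          simp only [hD, Finset.mul_sum]
          exact Finset.sum_congr rfl fun i _ => Finset.sum_congr rfl fun j _ =>
            Finset.sum_congr rfl fun b _ => Finset.sum_congr rfl fun b' _ => by ring
  have hrem : ∀ i τ ω, |f i (R τ ω) - f i ω - ∑ j, (Y (R τ ω) j - Y ω j) * D i j ω| ≤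
      p ^ 5 * α ^ 3 * L₃ * δ τ ω ^ 2 := by
    intro i τ ω
    have := H.abs_increment_sub_le hα hs i (U ω) (Y (R τ ω) - Y ω) (E.increment_le τ ω)
    have hUR : U ω + s • A.mulVec (Y (R τ ω) - Y ω) = U (R τ ω) := by
      simp only [hU, Matrix.mulVec_sub, smul_sub]; abel
    rw [hUR] at this
    exact this
  have hDle : ∀ i j ω, |D i j ω| ≤ p ^ 2 * α ^ 2 * L₂ := by
    intro i j ω
    rw [hD, abs_mul]
    refine (mul_le_of_le_one_left (abs_nonneg _) hs).trans ?_
    refine (Finset.abs_sum_le_sum_abs _ _).trans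
      ((Finset.sum_le_sum (g := fun _ => p * (α ^ 2 * L₂)) fun b _ => ?_).trans
        (le_of_eq (by simp; ring)))
    refine (Finset.abs_sum_le_sum_abs _ _).trans
      ((Finset.sum_le_sum (g := fun _ => α ^ 2 * L₂) fun b' _ => ?_).trans (by simp))
    rw [abs_mul, abs_mul, sq]
    exact mul_le_mul (mul_le_mul (hα _ _) (hα _ _) (abs_nonneg _) (hα0 i)) (H.hess_le _ _ _)
      (abs_nonneg _) (mul_self_nonneg α)
  -- Exact decomposition: drift minus `S` against the linear coefficients `D`, plus the Taylor
  -- remainders.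
  have main : ∑ ω, w ω * (∑ b, A.mulVec (Y ω) b * g₁ b (U ω) - s * ∑ b, g₂ b b (U ω)) =
      ∑ i, ((∑ j, ∑ ω, w ω * ((∑ τ, a i τ * (Y (R τ ω) j - Y ω j) - S i j) * D i j ω)) +
        ∑ ω, w ω * ∑ τ, a i τ *
          (f i (R τ ω) - f i ω - ∑ j, (Y (R τ ω) j - Y ω j) * D i j ω)) := by
    simp only [t1, t3, mul_sub (w _), Finset.sum_sub_distrib]
    have q1 : ∑ ω, w ω * ∑ i, Y ω i * f i ω =
        ∑ i, ∑ ω, w ω * ∑ τ, a i τ * (f i (R τ ω) - f i ω) := by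
      simp only [Finset.mul_sum (s := (Finset.univ : Finset (Fin p)))]
      rw [Finset.sum_comm]
      exact Finset.sum_congr rfl fun i _ => E.exchange i (f i)
    have q2 : ∑ ω, w ω * ∑ i, ∑ j, S i j * D i j ω = ∑ i, ∑ ω, w ω * ∑ j, S i j * D i j ω := by
      simp only [Finset.mul_sum]
      rw [Finset.sum_comm]
    rw [q1, q2, ← Finset.sum_sub_distrib]
    refine Finset.sum_congr rfl fun i _ => ?_
    rw [Finset.sum_comm, ← Finset.sum_sub_distrib, ← Finset.sum_add_distrib]
    refine Finset.sum_congr rfl fun ω _ => ?_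
    rw [← mul_sub, ← Finset.mul_sum, ← mul_add]
    congr 1
    have q3 : ∑ j, (∑ τ, a i τ * (Y (R τ ω) j - Y ω j)) * D i j ω =
        ∑ τ, a i τ * ∑ j, (Y (R τ ω) j - Y ω j) * D i j ω := by
      simp only [Finset.sum_mul, Finset.mul_sum]
      rw [Finset.sum_comm]
      exact Finset.sum_congr rfl fun τ _ => Finset.sum_congr rfl fun j _ => by ring
    simp only [sub_mul _ (S i _), mul_sub (a i _) (_ - _) (∑ _, _), Finset.sum_sub_distrib, q3]
    ring
  rw [main]
  have hb1 : ∀ i j, |∑ ω, w ω * ((∑ τ, a i τ * (Y (R τ ω) j - Y ω j) - S i j) * D i j ω)| ≤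
      p ^ 2 * α ^ 2 * L₂ * e₁ i := by
    intro i j
    have hnn : 0 ≤ p ^ 2 * α ^ 2 * L₂ :=
      mul_nonneg (by positivity) H.hess_nonneg
    refine (Finset.abs_sum_le_sum_abs _ _).trans
      (le_trans ?_ (mul_le_mul_of_nonneg_left (E.drift_le i j) hnn))
    rw [Finset.mul_sum]
    refine Finset.sum_le_sum fun ω _ => ?_
    rw [abs_mul, abs_mul, abs_of_nonneg (E.weight_nonneg ω)]
    calc _ ≤ w ω * (|∑ τ, a i τ * (Y (R τ ω) j - Y ω j) - S i j| * (p ^ 2 * α ^ 2 * L₂)) :=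
          mul_le_mul_of_nonneg_left (mul_le_mul_of_nonneg_left (hDle i j ω) (abs_nonneg _))
            (E.weight_nonneg ω)
      _ = _ := by ring
  have hb2 : ∀ i, |∑ ω, w ω * ∑ τ, a i τ *
      (f i (R τ ω) - f i ω - ∑ j, (Y (R τ ω) j - Y ω j) * D i j ω)| ≤
      p ^ 5 * α ^ 3 * L₃ * e₂ i := by
    intro i
    have hnn : 0 ≤ p ^ 5 * α ^ 3 * L₃ :=
      mul_nonneg (mul_nonneg (by positivity) (pow_nonneg (hα0 i) 3)) H.lip_nonneg
    refine (Finset.abs_sum_le_sum_abs _ _).trans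
      (le_trans ?_ (mul_le_mul_of_nonneg_left (E.sq_le i) hnn))
    rw [Finset.mul_sum]
    refine Finset.sum_le_sum fun ω _ => ?_
    rw [abs_mul, abs_of_nonneg (E.weight_nonneg ω), mul_left_comm]
    refine mul_le_mul_of_nonneg_left ?_ (E.weight_nonneg ω)
    rw [Finset.mul_sum]
    refine (Finset.abs_sum_le_sum_abs _ _).trans (Finset.sum_le_sum fun τ _ => ?_)
    rw [abs_mul, abs_of_nonneg (E.rate_nonneg i τ), mul_left_comm]
    exact mul_le_mul_of_nonneg_left (hrem i τ ω) (E.rate_nonneg i τ)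
  rw [Finset.mul_sum, Finset.mul_sum, ← Finset.sum_add_distrib]
  refine (Finset.abs_sum_le_sum_abs _ _).trans (Finset.sum_le_sum fun i _ => ?_)
  refine (abs_add_le _ _).trans (add_le_add ?_ (hb2 i))
  refine (Finset.abs_sum_le_sum_abs _ _).trans
    ((Finset.sum_le_sum fun j _ => hb1 i j).trans (le_of_eq (by simp; ring)))

theorem SmoothBounds.hasDerivAt_path (H : SmoothBounds h g₁ g₂ C L₂ L₃) (x z : Fin p → ℝ)
    (θ : ℝ) :
    HasDerivAt (fun θ : ℝ => h (Real.sin θ • x + Real.cos θ • z))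
      (∑ b, g₁ b (Real.sin θ • x + Real.cos θ • z) * (Real.cos θ * x b - Real.sin θ * z b)) θ := by
  have h1 := hasFDerivAt_of_lineDeriv_lipschitz H.grad H.hess_nonneg H.grad_lip
    (Real.sin θ • x + Real.cos θ • z)
  have h2 : HasDerivAt (fun θ : ℝ => Real.sin θ • x + Real.cos θ • z)
      (Real.cos θ • x + (-Real.sin θ) • z) θ :=
    ((Real.hasDerivAt_sin θ).smul_const x).add ((Real.hasDerivAt_cos θ).smul_const z)
  refine (h1.comp_hasDerivAt θ h2).congr_deriv ?_
  simp only [sum_apply, smul_apply, ContinuousLinearMap.proj_apply, smul_eq_mul, Pi.add_apply,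
    Pi.smul_apply]
  exact Finset.sum_congr rfl fun b _ => by ring

theorem SmoothBounds.integrable_stdNormal (H : SmoothBounds h g₁ g₂ C L₂ L₃) (x : Fin p → ℝ)
    (t : ℝ) : Integrable (fun z => h (x + t • z)) (stdNormal p) := by
  have h1 : Integrable (fun z : Fin p → ℝ => |h x| + C * ∑ k, |t| * |z k|) (stdNormal p) :=
    (integrable_const _).add ((integrable_finsetSum _ fun k _ =>
      ((integrable_eval_stdNormal k).abs.const_mul _)).const_mul _)
  have hc : Continuous fun z : Fin p → ℝ => h (x + t • z) := H.continuous.comp (by fun_prop)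
  refine h1.mono' hc.aestronglyMeasurable (Eventually.of_forall fun z => ?_)
  have := abs_sub_le_of_abs_lineDeriv_le H.grad H.grad_le x (x + t • z)
  simp only [Pi.add_apply, add_sub_cancel_left, Pi.smul_apply, smul_eq_mul, abs_mul] at this
  rw [Real.norm_eq_abs]
  have h2 := abs_sub_abs_le_abs_sub (h (x + t • z)) (h x)
  linarith

theorem SmoothBounds.integral_eval_mul_grad (H : SmoothBounds h g₁ g₂ C L₂ L₃) (x : Fin p → ℝ)
    (t : ℝ) (b : Fin p) :
    ∫ z, z b * g₁ b (x + t • z) ∂(stdNormal p) =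
      ∫ z, t * g₂ b b (x + t • z) ∂(stdNormal p) := by
  refine integral_eval_mul_stdNormal b (fun y => ?_) ((H.continuous_grad b).comp (by fun_prop))
    (continuous_const.mul ((H.continuous_hess b b).comp (by fun_prop))) (C := C) (C' := |t| * L₂)
    (fun y => H.grad_le b _) fun y => ?_
  · have h1 : HasDerivAt (fun s : ℝ => g₁ b (x + t • y + s • Pi.single b (1 : ℝ)))
        (g₂ b b (x + t • y)) (0 * t) := by
      rw [zero_mul]; exact H.hess b b _
    have h2 : HasDerivAt (fun s : ℝ => s * t) t 0 := by
      simpa using (hasDerivAt_id (0 : ℝ)).mul_const t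
    have h3 := HasDerivAt.comp (0 : ℝ) h1 h2
    rw [HasLineDerivAt, mul_comm]
    refine h3.congr_of_eventuallyEq (Eventually.of_forall fun s => ?_)
    simp only [Function.comp]
    congr 1
    rw [smul_add, smul_smul, mul_comm t, add_assoc]
  · rw [abs_mul]
    exact mul_le_mul_of_nonneg_left (H.hess_le _ _ _) (abs_nonneg _)

/-- Along sin θ X + cos θ Z the Gaussian part of the derivative becomes -sin θ cos θ Δh, leaving cos
θ times the approximate Stein identity at s = sin θ. The trigonometric parametrization keeps the
derivative bounded up to both endpoints. -/
theorem Exchange.abs_sum_sub_integral_le (E : Exchange w Y a R δ S e₁ e₂)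
    (H : SmoothBounds h g₁ g₂ C L₂ L₃) (hα : ∀ i j, |A i j| ≤ α)
    (hA : A * S * A.transpose = 1) :
    |∑ ω, w ω * h (A.mulVec (Y ω)) - ∫ z, h z ∂(stdNormal p)| ≤
      2 * (p ^ 3 * α ^ 2 * L₂ * ∑ i, e₁ i + p ^ 5 * α ^ 3 * L₃ * ∑ i, e₂ i) := by
  set K := p ^ 3 * α ^ 2 * L₂ * ∑ i, e₁ i + p ^ 5 * α ^ 3 * L₃ * ∑ i, e₂ i with hK
  -- Nonnegativity comes for free, since `K` bounds an absolute value.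
  have hK0 : 0 ≤ K := (abs_nonneg _).trans
    (E.abs_sum_grad_sub_hess_le H hα hA (s := 0) (by simp) 0)
  let X : Ω → Fin p → ℝ := fun ω => A.mulVec (Y ω)
  let U : ℝ → Ω → (Fin p → ℝ) → Fin p → ℝ := fun θ ω z => Real.sin θ • X ω + Real.cos θ • z
  let F : ℝ → (Fin p → ℝ) → ℝ := fun θ z => ∑ ω, w ω * h (U θ ω z)
  let F' : ℝ → (Fin p → ℝ) → ℝ := fun θ z => ∑ ω, w ω * ∑ b, g₁ b (U θ ω z) *
    (Real.cos θ * X ω b - Real.sin θ * z b)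
  have hUc : ∀ θ ω, Continuous (U θ ω) := fun θ ω => by
    change Continuous fun z : Fin p → ℝ => Real.sin θ • X ω + Real.cos θ • z
    fun_prop
  have hFint : ∀ θ, Integrable (F θ) (stdNormal p) := fun θ =>
    integrable_finsetSum _ fun ω _ => (H.integrable_stdNormal _ _).const_mul _
  have hFd : ∀ θ z, HasDerivAt (fun θ => F θ z) (F' θ z) θ := by
    intro θ z
    exact HasDerivAt.fun_sum fun ω _ => (H.hasDerivAt_path (X ω) z θ).const_mul (w ω)
  have hF'c : ∀ θ, Continuous (F' θ) := by
    intro θ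
    refine continuous_finsetSum _ fun ω _ => continuous_const.mul
      (continuous_finsetSum _ fun b _ => ((H.continuous_grad b).comp (hUc θ ω)).mul ?_)
    fun_prop
  have hderiv : ∀ θ, HasDerivAt (fun θ => ∫ z, F θ z ∂(stdNormal p))
      (∫ z, F' θ z ∂(stdNormal p)) θ := by
    intro θ
    refine (hasDerivAt_integral_of_dominated_loc_of_deriv_le (s := Set.univ) univ_mem
      (bound := fun z => ∑ ω, w ω * ∑ b, C * (|X ω b| + |z b|))
      (Eventually.of_forall fun θ => (hFint θ).aestronglyMeasurable) (hFint θ)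
      (hF'c θ).aestronglyMeasurable ?_ ?_ (Eventually.of_forall fun z θ _ => hFd θ z)).2
    · refine Eventually.of_forall fun z θ _ => ?_
      rw [Real.norm_eq_abs]
      refine (Finset.abs_sum_le_sum_abs _ _).trans (Finset.sum_le_sum fun ω _ => ?_)
      rw [abs_mul, abs_of_nonneg (E.weight_nonneg ω)]
      refine mul_le_mul_of_nonneg_left ?_ (E.weight_nonneg ω)
      refine (Finset.abs_sum_le_sum_abs _ _).trans (Finset.sum_le_sum fun b _ => ?_)
      rw [abs_mul]
      refine mul_le_mul (H.grad_le b _) ?_ (abs_nonneg _) ((abs_nonneg _).trans (H.grad_le b 0))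
      refine (abs_sub _ _).trans (add_le_add ?_ ?_)
      · rw [abs_mul]; exact mul_le_of_le_one_left (abs_nonneg _) (Real.abs_cos_le_one θ)
      · rw [abs_mul]; exact mul_le_of_le_one_left (abs_nonneg _) (Real.abs_sin_le_one θ)
    · exact integrable_finsetSum _ fun ω _ => (integrable_finsetSum _ fun b _ =>
        ((integrable_const _).add (integrable_eval_stdNormal b).abs).const_mul _).const_mul _
  have hbound : ∀ θ, |∫ z, F' θ z ∂(stdNormal p)| ≤ K := by
    intro θ
    have ig1 : ∀ ω b, Integrable (fun z => g₁ b (U θ ω z)) (stdNormal p) := fun ω b =>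
      Integrable.of_bound ((H.continuous_grad b).comp (hUc θ ω)).aestronglyMeasurable C
        (Eventually.of_forall fun z => H.grad_le b _)
    have ig2 : ∀ ω b, Integrable (fun z => g₂ b b (U θ ω z)) (stdNormal p) := fun ω b =>
      Integrable.of_bound ((H.continuous_hess b b).comp (hUc θ ω)).aestronglyMeasurable L₂
        (Eventually.of_forall fun z => H.hess_le b b _)
    have ig3 : ∀ ω b, Integrable (fun z => z b * g₁ b (U θ ω z)) (stdNormal p) := fun ω b =>
      (integrable_eval_stdNormal b).mul_bdd
        ((H.continuous_grad b).comp (hUc θ ω)).aestronglyMeasurable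
        (Eventually.of_forall fun z => H.grad_le b _)
    have hF'eq : ∫ z, F' θ z ∂(stdNormal p) = ∫ z, Real.cos θ * ∑ ω, w ω *
        (∑ b, X ω b * g₁ b (U θ ω z) - Real.sin θ * ∑ b, g₂ b b (U θ ω z)) ∂(stdNormal p) := by
      have e1 : ∀ z, F' θ z = ∑ ω, ∑ b, (w ω * (Real.cos θ * X ω b) * g₁ b (U θ ω z) -
          w ω * Real.sin θ * (z b * g₁ b (U θ ω z))) := by
        intro z
        simp only [F', Finset.mul_sum]
        exact Finset.sum_congr rfl fun ω _ => Finset.sum_congr rfl fun b _ => by ring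
      have e2 : ∀ z, Real.cos θ * ∑ ω, w ω *
          (∑ b, X ω b * g₁ b (U θ ω z) - Real.sin θ * ∑ b, g₂ b b (U θ ω z)) =
          ∑ ω, ∑ b, (w ω * (Real.cos θ * X ω b) * g₁ b (U θ ω z) -
          w ω * Real.sin θ * (Real.cos θ * g₂ b b (U θ ω z))) := by
        intro z
        simp only [Finset.mul_sum, ← Finset.sum_sub_distrib]
        exact Finset.sum_congr rfl fun ω _ => Finset.sum_congr rfl fun b _ => by ring
      simp only [e1, e2]
      have i1 : ∀ ω b, Integrable (fun z => w ω * (Real.cos θ * X ω b) * g₁ b (U θ ω z))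
          (stdNormal p) := fun ω b => (ig1 ω b).const_mul _
      have i2 : ∀ ω b, Integrable (fun z => w ω * Real.sin θ * (Real.cos θ * g₂ b b (U θ ω z)))
          (stdNormal p) := fun ω b => ((ig2 ω b).const_mul _).const_mul _
      have i3 : ∀ ω b, Integrable (fun z => w ω * Real.sin θ * (z b * g₁ b (U θ ω z)))
          (stdNormal p) := fun ω b => (ig3 ω b).const_mul _
      have i13 : ∀ ω b, Integrable (fun z => w ω * (Real.cos θ * X ω b) * g₁ b (U θ ω z) -
          w ω * Real.sin θ * (z b * g₁ b (U θ ω z))) (stdNormal p) :=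
        fun ω b => (i1 ω b).sub (i3 ω b)
      have i12 : ∀ ω b, Integrable (fun z => w ω * (Real.cos θ * X ω b) * g₁ b (U θ ω z) -
          w ω * Real.sin θ * (Real.cos θ * g₂ b b (U θ ω z))) (stdNormal p) :=
        fun ω b => (i1 ω b).sub (i2 ω b)
      rw [integral_finsetSum _ fun ω _ => integrable_finsetSum _ fun b _ => i13 ω b,
        integral_finsetSum _ fun ω _ => integrable_finsetSum _ fun b _ => i12 ω b]
      refine Finset.sum_congr rfl fun ω _ => ?_
      rw [integral_finsetSum _ fun b _ => i13 ω b, integral_finsetSum _ fun b _ => i12 ω b]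
      refine Finset.sum_congr rfl fun b _ => ?_
      rw [integral_sub (i1 ω b) (i3 ω b), integral_sub (i1 ω b) (i2 ω b)]
      congr 1
      rw [integral_const_mul, integral_const_mul]
      congr 1
      exact H.integral_eval_mul_grad _ _ b
    rw [hF'eq]
    have := norm_integral_le_of_norm_le_const (μ := stdNormal p) (C := K)
      (f := fun z => Real.cos θ * ∑ ω, w ω *
        (∑ b, X ω b * g₁ b (U θ ω z) - Real.sin θ * ∑ b, g₂ b b (U θ ω z)))
      (Eventually.of_forall fun z => by
        rw [Real.norm_eq_abs, abs_mul]
        exact (mul_le_of_le_one_left (abs_nonneg _) (Real.abs_cos_le_one θ)).trans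
          (E.abs_sum_grad_sub_hess_le H hα hA (Real.abs_sin_le_one θ) _))
    simpa using this
  have hmv := Convex.norm_image_sub_le_of_norm_hasDerivWithin_le (s := Set.univ) (C := K)
    (f := fun θ => ∫ z, F θ z ∂(stdNormal p)) (fun θ _ => (hderiv θ).hasDerivWithinAt)
    (fun θ _ => hbound θ) convex_univ (Set.mem_univ 0) (Set.mem_univ (Real.pi / 2))
  have v1 : ∫ z, F (Real.pi / 2) z ∂(stdNormal p) = ∑ ω, w ω * h (A.mulVec (Y ω)) := by
    simp [F, U, X]
  have v0 : ∫ z, F 0 z ∂(stdNormal p) = ∫ z, h z ∂(stdNormal p) := by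
    simp [F, U, ← Finset.sum_mul, E.sum_weight]
  simp only [v1, v0] at hmv
  rw [Real.norm_eq_abs] at hmv
  refine hmv.trans ?_
  rw [sub_zero, Real.norm_eq_abs, abs_of_pos (by positivity), mul_comm]
  -- The factor 2 bounds the path length π/2.
  exact mul_le_mul_of_nonneg_right (by linarith [Real.pi_le_four]) hK0

end SmartPath

/-! ### The explicit error bound for degree counts -/

section ErrorBound

variable {n p : ℕ} {c : ℝ} {d : Fin p → ℕ}

/-- A move is a pair (vertex, replacement graph), with rate the weight of that graph times the
indicator that its degree there is `d i`. The first error is the standard deviation of a vertex sum;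
the second is the mean of (1 + old degree + new degree)², with the new degree pinned to `d i`. -/
theorem exchange_degreeCount (hc : 0 < c) (hcn : c < (n : ℝ) - 1)
    (hβ : ∀ i, 0 < beta n c d i) :
    Exchange (Ω := SimpleGraph (Fin n)) (T := Fin n × SimpleGraph (Fin n))
      (graphWeight (c / ((n : ℝ) - 1))) (fun G => degreeCount d G - meanVec n c d)
      (fun i τ => graphWeight (c / ((n : ℝ) - 1)) τ.2 * indFun (d i) (deg τ.2 τ.1))
      (fun τ G => graftStar τ.1 G τ.2) (fun τ G => 1 + deg G τ.1 + deg τ.2 τ.1)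
      (covMatrix n c d) (fun i => 2 * √n * (beta n c d i * (1 + d i + c)))
      (fun i => 2 * n * (beta n c d i * (1 + d i + c) ^ 2)) := by
  have hn := two_le_of_lt hc hcn
  have h1 : (0 : ℝ) < n - 1 := hc.trans hcn
  set q := c / ((n : ℝ) - 1) with hq
  have hq0 : 0 < q := by positivity
  have hq1 : q < 1 := (div_lt_one h1).2 hcn
  have hN := cast_pred hc hcn
  have hNq : ((n - 1 : ℕ) : ℝ) * q = c := by rw [hN, hq]; field_simp
  have hcard : Fintype.card (Fin n) = (n - 1) + 1 := by rw [Fintype.card_fin]; omega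
  have hcard2 : 2 ≤ Fintype.card (Fin n) := by rw [Fintype.card_fin]; omega
  have hcard' : Fintype.card (Fin n) - 1 = n - 1 := by rw [Fintype.card_fin]
  have hY : ∀ (G : SimpleGraph (Fin n)) i, (degreeCount d G - meanVec n c d) i =
      degSum (indFun (d i)) G - n * binomMean q (n - 1) (indFun (d i)) := by
    intro G i
    rw [Pi.sub_apply, degreeCount_eq_degSum, meanVec_eq hc hcn, binomMean_indFun, beta_eq]
  have hex : ∀ i (f : SimpleGraph (Fin n) → ℝ),
      ∑ G, graphWeight q G * ((degreeCount d G - meanVec n c d) i * f G) =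
      ∑ G, graphWeight q G * ∑ τ : Fin n × SimpleGraph (Fin n),
        graphWeight q τ.2 * indFun (d i) (deg τ.2 τ.1) * (f (graftStar τ.1 G τ.2) - f G) := by
    intro i f
    have h := graphMean_degSum_sub_mul q (indFun (d i)) f
    rw [hcard', Fintype.card_fin] at h
    simp only [hY]
    rw [graphMean] at h
    rw [h]
    simp only [graphMean, Fintype.sum_prod_type, mul_assoc]
  have hdrift : ∀ i j (G : SimpleGraph (Fin n)), ∑ τ : Fin n × SimpleGraph (Fin n),
      graphWeight q τ.2 * indFun (d i) (deg τ.2 τ.1) *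
        ((degreeCount d (graftStar τ.1 G τ.2) - meanVec n c d) j -
          (degreeCount d G - meanVec n c d) j) =
      n * binomMean q (n - 1) (fun k => indFun (d i) k * indFun (d j) k) +
        degSum (driftFun (n - 1 : ℕ) (beta n c d i) (beta n c d i * d i / (n - 1 : ℕ))
          (indFun (d j))) G := by
    intro i j G
    have e := sum_graphMean_increment hcard2 q (indFun (d i)) (indFun (d j)) G hcard
      (m := beta n c d i) (κ := beta n c d i * d i / (n - 1 : ℕ)) (by rw [binomMean_indFun]; rfl)
      (by rw [binomMean_indFun_mul]; rfl)
    rw [Fintype.card_fin] at e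
    rw [← e]
    simp only [hY, sub_sub_sub_cancel_right, graphMean, Fintype.sum_prod_type, mul_assoc]
  refine ⟨graphWeight_nonneg hq0.le hq1.le, sum_graphWeight q, fun i τ =>
    mul_nonneg (graphWeight_nonneg hq0.le hq1.le _) (indFun_nonneg _ _), hex, ?_, ?_, ?_⟩
  · intro τ G j
    rw [hY, hY, sub_sub_sub_cancel_right]
    exact abs_degSum_graftStar_sub_le (indFun_nonneg _) (indFun_le_one _) _ _ _
  · intro i j
    set χ := driftFun (n - 1 : ℕ) (beta n c d i) (beta n c d i * d i / (n - 1 : ℕ))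
      (indFun (d j)) with hχ
    -- Testing the exchange identity against the j-th centred count shows that the mean drift is Σ,
    -- so the deviation is a centred vertex sum of χ.
    have hS : covMatrix n c d i j =
        n * binomMean q (n - 1) (fun k => indFun (d i) k * indFun (d j) k) +
          n * binomMean q (n - 1) χ := by
      have h := hex i (fun G => (degreeCount d G - meanVec n c d) j)
      simp only [hdrift] at h
      rw [covMatrix_eq_graphMean hc hcn]
      refine h.trans ?_
      rw [← graphMean, graphMean_add, graphMean_const,
        show graphMean q (fun G : SimpleGraph (Fin n) => degSum χ G) = _ from graphMean_degSum q χ,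
        hcard', Fintype.card_fin]
    -- Positivity of β(i) rules out larger degrees; this gives κ ≤ m in the drift estimate.
    have hdN : d i ≤ n - 1 := by
      by_contra hlt
      have := hβ i
      rw [beta, Nat.choose_eq_zero_of_lt (by omega)] at this
      simp at this
    have hdN' : (d i : ℝ) ≤ (n - 1 : ℕ) := by exact_mod_cast hdN
    have hN0 : (0 : ℝ) < (n - 1 : ℕ) := by rw [hN]; exact h1
    have hχle : ∀ k ≤ n - 1, χ k ^ 2 ≤ beta n c d i ^ 2 * (1 + d i + k) ^ 2 := by
      intro k hk
      have := abs_driftFun_le (κ := beta n c d i * d i / (n - 1 : ℕ)) (m := beta n c d i)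
        (div_nonneg (mul_nonneg (hβ i).le (Nat.cast_nonneg _)) hN0.le)
        ((div_le_iff₀ hN0).2 (mul_le_mul_of_nonneg_left hdN' (hβ i).le))
        (indFun_nonneg (d j)) (indFun_le_one (d j)) hk
      rw [div_mul_cancel₀ _ hN0.ne'] at this
      rw [← sq_abs, ← mul_pow]
      exact pow_le_pow_left₀ (abs_nonneg _) (this.trans (le_of_eq (by ring))) 2
    have hvar := graphMean_sq_degSum_sub_le hcard2 hq0 hq1 χ hcard
    rw [Fintype.card_fin] at hvar
    have hm : binomMean q (n - 1) (fun k => χ k ^ 2) ≤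
        beta n c d i ^ 2 * (2 * (1 + d i + c) ^ 2) := by
      refine (binomMean_mono hq0.le hq1.le hχle).trans ?_
      rw [binomMean_const_mul]
      refine mul_le_mul_of_nonneg_left ?_ (sq_nonneg _)
      have h := binomMean_sq_add_le hq0.le (n - 1) (a := 1 + d i)
        (le_add_of_nonneg_right (Nat.cast_nonneg _))
      rwa [hNq] at h
    simp only [hdrift, hS, add_sub_add_left_eq_sub]
    refine (graphMean_abs_le_sqrt hq0.le hq1.le _).trans ?_
    have hnn : 0 ≤ beta n c d i * (1 + d i + c) := mul_nonneg (hβ i).le (by positivity)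
    rw [Real.sqrt_le_left (by positivity), mul_pow, mul_pow, Real.sq_sqrt (Nat.cast_nonneg n)]
    refine hvar.trans ?_
    refine (mul_le_mul_of_nonneg_left hm (by positivity)).trans (le_of_eq (by ring))
  · intro i
    have h : ∀ G : SimpleGraph (Fin n), ∑ τ : Fin n × SimpleGraph (Fin n),
        graphWeight q τ.2 * indFun (d i) (deg τ.2 τ.1) * (1 + deg G τ.1 + deg τ.2 τ.1) ^ 2 =
        ∑ v, beta n c d i * (1 + d i + deg G v) ^ 2 := by
      intro G
      rw [Fintype.sum_prod_type]
      refine Finset.sum_congr rfl fun v _ => ?_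
      have := graphMean_deg q v (fun k => indFun (d i) k * (1 + deg G v + k) ^ 2)
      rw [hcard', binomMean_indFun_mul q (n - 1) (d i) (fun k => (1 + deg G v + k) ^ 2)] at this
      simp only [graphMean, ← mul_assoc] at this
      rw [this, beta_eq]
      ring
    simp only [h]
    rw [← graphMean, graphMean_sum]
    have h2 : ∀ v : Fin n, graphMean q (fun G : SimpleGraph (Fin n) =>
        beta n c d i * (1 + d i + deg G v) ^ 2) ≤ beta n c d i * (2 * (1 + d i + c) ^ 2) := by
      intro v
      rw [graphMean_const_mul, graphMean_deg q v (fun k => (1 + d i + k : ℝ) ^ 2), hcard']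
      refine mul_le_mul_of_nonneg_left ?_ (hβ i).le
      have h := binomMean_sq_add_le hq0.le (n - 1) (a := 1 + d i)
        (le_add_of_nonneg_right (Nat.cast_nonneg _))
      rwa [hNq] at h
    refine (Finset.sum_le_sum fun v _ => h2 v).trans (le_of_eq ?_)
    simp
    ring

theorem HasBoundedPartials.abs_mixedPartial_le {h : (Fin p → ℝ) → ℝ} (H : HasBoundedPartials h)
    {k : ℕ} (h1 : 1 ≤ k) (h3 : k ≤ 3) (s : Fin k → Fin p) (x : Fin p → ℝ) :
    |mixedPartial h (List.ofFn s) x| ≤ derivNorm k h := by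
  have hb : ∀ s : Fin k → Fin p, ∃ C : ℝ, ∀ x, |mixedPartial h (List.ofFn s) x| ≤ C := fun s =>
    H.bounded _ (by simpa using h1) (by simpa using h3)
  choose C hC using hb
  -- A real supremum is informative only if bounded above; there are finitely many index tuples, so
  -- their bounds can be added.
  refine le_ciSup (f := fun q : (Fin k → Fin p) × (Fin p → ℝ) =>
    |mixedPartial h (List.ofFn q.1) q.2|) ⟨∑ s, |C s|, ?_⟩ (s, x)
  rintro _ ⟨⟨s, x⟩, rfl⟩
  exact ((hC s x).trans (le_abs_self _)).trans
    (Finset.single_le_sum (f := fun s => |C s|) (fun _ _ => abs_nonneg _) (Finset.mem_univ s))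

theorem derivNorm_nonneg (k : ℕ) (h : (Fin p → ℝ) → ℝ) : 0 ≤ derivNorm k h :=
  Real.iSup_nonneg fun _ => abs_nonneg _

theorem HasBoundedPartials.hasLineDerivAt {h : (Fin p → ℝ) → ℝ} (H : HasBoundedPartials h)
    (i : Fin p) (l : List (Fin p)) (hl : l.length < 3) (x : Fin p → ℝ) :
    HasLineDerivAt ℝ (mixedPartial h l) (mixedPartial h (i :: l) x) x (Pi.single i 1) :=
  (H.exist i l hl x).hasLineDerivAt

theorem HasBoundedPartials.smoothBounds {h : (Fin p → ℝ) → ℝ} (H : HasBoundedPartials h) :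
    SmoothBounds h (fun a => mixedPartial h [a]) (fun a b => mixedPartial h [b, a])
      (derivNorm 1 h) (derivNorm 2 h) (derivNorm 3 h) where
  grad a x := H.hasLineDerivAt a [] (by simp) x
  hess a b x := H.hasLineDerivAt b [a] (by simp) x
  grad_le a x := H.abs_mixedPartial_le le_rfl (by norm_num) ![a] x
  hess_le a b x := H.abs_mixedPartial_le (by norm_num) (by norm_num) ![b, a] x
  hess_lip a b := abs_sub_le_of_abs_lineDeriv_le
    (fun j x => H.hasLineDerivAt j [b, a] (by simp) x)
    fun j x => H.abs_mixedPartial_le (by norm_num) le_rfl ![j, b, a] x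
  hess_nonneg := derivNorm_nonneg _ _
  lip_nonneg := derivNorm_nonneg _ _

theorem sum_beta_mul_le (hc : 0 < c) (hcn : c < (n : ℝ) - 1) (hd : Function.Injective d) :
    ∑ i, beta n c d i * (1 + d i + c) ≤ 1 + 2 * c ∧
      ∑ i, beta n c d i * (1 + d i + c) ^ 2 ≤ 2 * (1 + 2 * c) ^ 2 := by
  have h1 : (0 : ℝ) < n - 1 := hc.trans hcn
  have hq0 : 0 ≤ c / ((n : ℝ) - 1) := by positivity
  have hq1 : c / ((n : ℝ) - 1) ≤ 1 := (div_le_one h1).2 hcn.le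
  have hNq : ((n - 1 : ℕ) : ℝ) * (c / ((n : ℝ) - 1)) = c := by
    rw [cast_pred hc hcn]; field_simp
  constructor
  · refine (sum_binomProb_mul_le hq0 hq1 (n - 1) hd (g := fun k => 1 + k + c)
      fun k => by positivity).trans (le_of_eq ?_)
    have e : (fun k : ℕ => 1 + (k : ℝ) + c) = fun k : ℕ => (1 + c) * 1 + (k : ℝ) := by
      ext k; ring
    rw [e, binomMean_add, binomMean_const_mul, binomMean_one, binomMean_id, hNq]
    ring
  · refine (sum_binomProb_mul_le hq0 hq1 (n - 1) hd (g := fun k => (1 + k + c) ^ 2)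
      fun k => by positivity).trans ?_
    have h := binomMean_sq_add_le hq0 (n - 1) (a := 1 + c) (by linarith)
    rw [hNq] at h
    have e : (fun k : ℕ => (1 + (k : ℝ) + c) ^ 2) = fun k : ℕ => (1 + c + (k : ℝ)) ^ 2 := by
      ext k; ring
    rw [e]
    exact h.trans (le_of_eq (by ring))

/-- With α = √(B/n), the terms α²·√n and α³·n both have order n^(-1/2), with B and B^(3/2). The
constant 64 is twice the larger of the constants 6 and 32 obtained below. -/
theorem abs_integral_standardized_sub_le (hp : 1 ≤ p) (hc : 0 < c) (hcn : c < (n : ℝ) - 1)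
    (hd : Function.Injective d) (hβ : ∀ i, 0 < beta n c d i) (hs : ∑ i, beta n c d i < 1)
    {h : (Fin p → ℝ) → ℝ} (H : HasBoundedPartials h) :
    |(∫ G, h (standardized n c d G) ∂(graphLaw n c)) - ∫ z, h z ∂(stdNormal p)| ≤
      (n : ℝ) ^ (-(1 / 2) : ℝ) * 64 *
        ((p : ℝ) ^ 3 * bigB n c d * derivNorm 2 h * (1 + c ^ (5 / 2 : ℝ)) *
            (((n : ℝ) - 1) / ((n : ℝ) - 1 - c)) ^ (1 / 2 : ℝ) +
          (p : ℝ) ^ 5 * bigB n c d ^ (3 / 2 : ℝ) * derivNorm 3 h * (1 + c ^ 2)) := by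
  have hS := covMatrix_posDef hc hcn hd hβ hs
  obtain ⟨hB, hquad⟩ := quadratic_lower_bound_bigB hp hc hcn hd hβ hs
  have hn : (0 : ℝ) < n := by linarith
  have hα := abs_invSqrt_apply_le hS (div_pos hn hB) hquad
  have hmain := (exchange_degreeCount hc hcn hβ).abs_sum_sub_integral_le H.smoothBounds hα
    (invSqrt_mul_mul_transpose hS)
  rw [integral_graphLaw hc hcn]
  refine hmain.trans ?_
  rw [← Finset.mul_sum, ← Finset.mul_sum]
  obtain ⟨hs1, hs2⟩ := sum_beta_mul_le hc hcn hd
  set s1 := ∑ i, beta n c d i * (1 + d i + c)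
  set s2 := ∑ i, beta n c d i * (1 + d i + c) ^ 2
  set b := √(bigB n c d) with hb
  set m := √(n : ℝ) with hm
  have hb0 : 0 < b := Real.sqrt_pos.2 hB
  have hm0 : 0 < m := Real.sqrt_pos.2 hn
  have hbB : bigB n c d = b ^ 2 := (Real.sq_sqrt hB.le).symm
  have hmn : (n : ℝ) = m ^ 2 := (Real.sq_sqrt hn.le).symm
  have hB3 : bigB n c d ^ (3 / 2 : ℝ) = b ^ 3 := by
    rw [hbB, ← Real.rpow_natCast, ← Real.rpow_mul hb0.le, ← Real.rpow_natCast]; norm_num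
  have hn2 : (n : ℝ) ^ (-(1 / 2) : ℝ) = m⁻¹ := by
    rw [Real.rpow_neg hn.le, hm, Real.sqrt_eq_rpow]
  have hα' : √(1 / ((n : ℝ) / bigB n c d)) = b / m := by
    rw [one_div_div, Real.sqrt_div hB.le]
  -- The argument gives 1 + 2c for the first term; this factor and the power 5/2 only enlarge it to
  -- the stated form.
  have hfac : 1 ≤ (((n : ℝ) - 1) / ((n : ℝ) - 1 - c)) ^ (1 / 2 : ℝ) :=
    Real.one_le_rpow ((one_le_div (by linarith)).2 (by linarith)) (by norm_num)
  have hc52 : c ≤ 1 + c ^ (5 / 2 : ℝ) := by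
    rcases le_total c 1 with h1 | h1
    · have := Real.rpow_nonneg hc.le (5 / 2 : ℝ); linarith
    · have := Real.rpow_le_rpow_of_exponent_le h1 (show (1 : ℝ) ≤ 5 / 2 by norm_num)
      rw [Real.rpow_one] at this; linarith
  have hc0 : 0 ≤ c ^ (5 / 2 : ℝ) := Real.rpow_nonneg hc.le _
  have hL2 := derivNorm_nonneg 2 h
  have hL3 := derivNorm_nonneg 3 h
  rw [hB3, hα', hn2, hbB]
  have t1 : (p : ℝ) ^ 3 * (b / m) ^ 2 * derivNorm 2 h * (2 * m * s1) ≤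
      m⁻¹ * 6 * (p ^ 3 * b ^ 2 * derivNorm 2 h * (1 + c ^ (5 / 2 : ℝ))) := by
    have : s1 ≤ 3 * (1 + c ^ (5 / 2 : ℝ)) := by linarith
    calc (p : ℝ) ^ 3 * (b / m) ^ 2 * derivNorm 2 h * (2 * m * s1)
        ≤ (p : ℝ) ^ 3 * (b / m) ^ 2 * derivNorm 2 h * (2 * m * (3 * (1 + c ^ (5 / 2 : ℝ)))) := by
          gcongr
      _ = _ := by field_simp; ring
  have t2 : (p : ℝ) ^ 5 * (b / m) ^ 3 * derivNorm 3 h * (2 * n * s2) ≤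
      m⁻¹ * 32 * (p ^ 5 * b ^ 3 * derivNorm 3 h * (1 + c ^ 2)) := by
    have : s2 ≤ 16 * (1 + c ^ 2) := by nlinarith [sq_nonneg (2 * c - 1), sq_nonneg (c - 1)]
    calc (p : ℝ) ^ 5 * (b / m) ^ 3 * derivNorm 3 h * (2 * n * s2)
        ≤ (p : ℝ) ^ 5 * (b / m) ^ 3 * derivNorm 3 h * (2 * n * (16 * (1 + c ^ 2))) := by
          gcongr
      _ = _ := by rw [hmn]; field_simp; ring
  have hQ : 0 ≤ m⁻¹ * (p ^ 3 * b ^ 2 * derivNorm 2 h * (1 + c ^ (5 / 2 : ℝ))) := by positivity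
  have t3 : m⁻¹ * (p ^ 3 * b ^ 2 * derivNorm 2 h * (1 + c ^ (5 / 2 : ℝ))) ≤
      m⁻¹ * (p ^ 3 * b ^ 2 * derivNorm 2 h * (1 + c ^ (5 / 2 : ℝ))) *
      (((n : ℝ) - 1) / ((n : ℝ) - 1 - c)) ^ (1 / 2 : ℝ) := le_mul_of_one_le_right hQ hfac
  linarith

end ErrorBound

/-! ### Convergence in distribution for fixed c and d -/

section Convergence

variable {p : ℕ}

theorem hasLineDerivAt_cos_dotProduct (t : Fin p → ℝ) (K ψ : ℝ) (i : Fin p) (x : Fin p → ℝ) :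
    HasLineDerivAt ℝ (fun x => K * Real.cos (t ⬝ᵥ x + ψ))
      (K * (t i * Real.cos (t ⬝ᵥ x + (ψ + Real.pi / 2)))) x (Pi.single i 1) := by
  have h1 : HasDerivAt (fun s : ℝ => t ⬝ᵥ x + s * t i + ψ) (t i) 0 := by
    simpa using (((hasDerivAt_id (0 : ℝ)).mul_const (t i)).const_add (t ⬝ᵥ x)).add_const ψ
  have h2 := h1.cos.const_mul K
  rw [HasLineDerivAt]
  refine (h2.congr_deriv ?_).congr_of_eventuallyEq (Eventually.of_forall fun s => ?_)
  · rw [← add_assoc, Real.cos_add_pi_div_two]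
    simp only [zero_mul, add_zero]
    ring
  · simp [dotProduct_add]

/-- Each derivative multiplies by a coordinate of `t` and shifts the phase by π/2, so cosines with a
free phase form a closed family of admissible test functions. -/
theorem mixedPartial_cos_dotProduct (t : Fin p → ℝ) (ψ : ℝ) (l : List (Fin p)) :
    mixedPartial (fun x => Real.cos (t ⬝ᵥ x + ψ)) l =
      fun x => (l.map t).prod * Real.cos (t ⬝ᵥ x + (ψ + l.length * (Real.pi / 2))) := by
  induction l with
  | nil => simp [mixedPartial]
  | cons i l ih =>
    ext x
    rw [mixedPartial, ih]
    dsimp only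
    rw [(hasLineDerivAt_cos_dotProduct t _ _ i x).lineDeriv]
    simp only [List.map_cons, List.prod_cons, List.length_cons, Nat.cast_add, Nat.cast_one]
    rw [show ψ + (l.length + 1 : ℝ) * (Real.pi / 2) = ψ + l.length * (Real.pi / 2) + Real.pi / 2 by
      ring]
    ring

theorem hasBoundedPartials_cos_dotProduct (t : Fin p → ℝ) (ψ : ℝ) :
    HasBoundedPartials fun x => Real.cos (t ⬝ᵥ x + ψ) where
  exist i l _ x := by
    rw [mixedPartial_cos_dotProduct]
    exact (hasLineDerivAt_cos_dotProduct t _ _ i x).lineDifferentiableAt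
  bounded l _ _ := ⟨|(l.map t).prod|, fun x => by
    rw [mixedPartial_cos_dotProduct, abs_mul]
    exact mul_le_of_le_one_right (abs_nonneg _) (Real.abs_cos_le_one _)⟩

/-- The limiting Poisson probabilities. -/
noncomputable def poissonProb (c : ℝ) (k : ℕ) : ℝ := Real.exp (-c) * c ^ k / k.factorial

theorem tendsto_beta (c : ℝ) (d : Fin p → ℕ) (i : Fin p) :
    Tendsto (fun n => beta n c d i) atTop (nhds (poissonProb c (d i))) := by
  have h1 : Tendsto (fun n : ℕ => (n : ℝ) * (c / n)) atTop (nhds c) := by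
    refine tendsto_const_nhds.congr' ?_
    filter_upwards [eventually_ge_atTop 1] with n hn
    have : (n : ℝ) ≠ 0 := by exact_mod_cast (show n ≠ 0 by omega)
    field_simp
  -- The Poisson limit is taken with n trials of probability c/n and then shifted to n - 1.
  have h2 := (tendsto_choose_mul_pow_of_tendsto_mul_atTop (d i) h1).comp (tendsto_sub_atTop_nat 1)
  refine h2.congr' ?_
  filter_upwards [eventually_ge_atTop 1] with n hn
  simp only [Function.comp, beta, Nat.cast_sub hn, Nat.cast_one]

/-- Some integer outside the finite range of `d` carries positive Poisson mass. -/
theorem sum_poissonProb_lt_one {c : ℝ} (hc : 0 < c) {d : Fin p → ℕ} (hd : Function.Injective d) :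
    ∑ i, poissonProb c (d i) < 1 := by
  have hs : HasSum (poissonProb c) 1 := hasSum_one_poissonMeasure ⟨c, hc.le⟩
  have hpos : ∀ k, 0 < poissonProb c k := fun k => by unfold poissonProb; positivity
  obtain ⟨k, hk⟩ := Infinite.exists_notMem_finset (Finset.univ.image d)
  have h := sum_le_hasSum (insert k (Finset.univ.image d)) (fun k _ => (hpos k).le) hs
  rw [Finset.sum_insert hk, Finset.sum_image hd.injOn] at h
  linarith [hpos k]

theorem tendsto_integral_standardized {c : ℝ} (hc : 0 < c) {d : Fin p → ℕ}
    (hd : Function.Injective d) {h : (Fin p → ℝ) → ℝ} (H : HasBoundedPartials h) :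
    Tendsto (fun n : ℕ => ∫ G, h (standardized n c d G) ∂(graphLaw n c)) atTop
      (nhds (∫ z, h z ∂(stdNormal p))) := by
  -- The error bound needs p ≥ 1; for p = 0 the space is a point and both sides agree.
  rcases Nat.eq_zero_or_pos p with rfl | hp
  · have : ∀ x, h x = h 0 := fun x => congrArg h (Subsingleton.elim _ _)
    simp [this]
  have : Nonempty (Fin p) := ⟨⟨0, hp⟩⟩
  have hpos : ∀ k, 0 < poissonProb c k := fun k => by unfold poissonProb; positivity
  obtain ⟨i₀, hi₀⟩ := Finite.exists_min fun i => poissonProb c (d i)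
  set μ := poissonProb c (d i₀) with hμ
  have hμ0 : 0 < μ := hpos _
  set σ := 1 - ∑ i, poissonProb c (d i) with hσ
  have hσ0 : 0 < σ := sub_pos.2 (sum_poissonProb_lt_one hc hd)
  have ev1 : ∀ᶠ n : ℕ in atTop, ∀ i, μ / 2 < beta n c d i := by
    rw [eventually_all]
    exact fun i => (tendsto_beta c d i).eventually_const_lt
      (lt_of_lt_of_le (by linarith) (hi₀ i))
  have ev2 : ∀ᶠ n : ℕ in atTop, σ / 2 < 1 - ∑ i, beta n c d i :=
    (tendsto_const_nhds.sub (tendsto_finsetSum _ fun i _ => tendsto_beta c d i)).eventually_const_lt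
      (show σ / 2 < σ by linarith)
  -- This threshold makes (n - 1)/(n - 1 - c) at most 2.
  have ev3 : ∀ᶠ n : ℕ in atTop, 2 * c + 1 < (n : ℝ) :=
    tendsto_natCast_atTop_atTop.eventually_gt_atTop _
  set K := 1 / (μ / 2 * (σ / 2)) with hK
  have hK0 : 0 < K := by positivity
  have hL2 := derivNorm_nonneg 2 h
  have hL3 := derivNorm_nonneg 3 h
  have hlim : Tendsto (fun n : ℕ => (n : ℝ) ^ (-(1 / 2) : ℝ) * 64 *
      ((p : ℝ) ^ 3 * K * derivNorm 2 h * (1 + c ^ (5 / 2 : ℝ)) * 2 ^ (1 / 2 : ℝ) +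
        (p : ℝ) ^ 5 * K ^ (3 / 2 : ℝ) * derivNorm 3 h * (1 + c ^ 2))) atTop (nhds 0) := by
    have := (tendsto_rpow_neg_atTop (show (0 : ℝ) < 1 / 2 by norm_num)).comp
      (tendsto_natCast_atTop_atTop (R := ℝ))
    simpa using (this.mul_const 64).mul_const
      ((p : ℝ) ^ 3 * K * derivNorm 2 h * (1 + c ^ (5 / 2 : ℝ)) * 2 ^ (1 / 2 : ℝ) +
        (p : ℝ) ^ 5 * K ^ (3 / 2 : ℝ) * derivNorm 3 h * (1 + c ^ 2))
  rw [tendsto_iff_norm_sub_tendsto_zero]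
  refine squeeze_zero' (Eventually.of_forall fun _ => norm_nonneg _) ?_ hlim
  filter_upwards [ev1, ev2, ev3] with n h1 h2 h3
  have hcn : c < (n : ℝ) - 1 := by linarith
  have hβ : ∀ i, 0 < beta n c d i := fun i => lt_trans (by linarith) (h1 i)
  have hs : ∑ i, beta n c d i < 1 := by linarith
  refine (abs_integral_standardized_sub_le hp hc hcn hd hβ hs H).trans ?_
  have hB : bigB n c d ≤ K := by
    unfold bigB
    refine one_div_le_one_div_of_le (by positivity) ?_
    exact mul_le_mul (le_ciInf fun i => (h1 i).le) h2.le (by positivity)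
      (le_ciInf fun i => (hβ i).le)
  have hB0 : 0 ≤ bigB n c d := (quadratic_lower_bound_bigB hp hc hcn hd hβ hs).1.le
  have hf : ((n : ℝ) - 1) / ((n : ℝ) - 1 - c) ≤ 2 := by
    rw [div_le_iff₀ (by linarith)]; linarith
  have hf0 : 0 ≤ ((n : ℝ) - 1) / ((n : ℝ) - 1 - c) :=
    div_nonneg (by linarith) (by linarith)
  have hc0 : 0 ≤ c ^ (5 / 2 : ℝ) := Real.rpow_nonneg hc.le _
  gcongr

/-- Phases 0 and -π/2 give cosine and sine, so real and imaginary parts come from one family of test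
functions. -/
theorem charFun_map_eq {Ω : Type*} {m : MeasurableSpace Ω} (μ : Measure Ω) [IsProbabilityMeasure μ]
    {X : Ω → Fin p → ℝ} (hX : AEMeasurable X μ) (t : EuclideanSpace ℝ (Fin p)) :
    charFun (μ.map fun ω => WithLp.toLp 2 (X ω)) t =
      ((∫ ω, Real.cos (t.ofLp ⬝ᵥ X ω + 0) ∂μ : ℝ) : ℂ) +
        ((∫ ω, Real.cos (t.ofLp ⬝ᵥ X ω + -(Real.pi / 2)) ∂μ : ℝ) : ℂ) * Complex.I := by
  have hm : AEMeasurable (fun ω => WithLp.toLp 2 (X ω)) μ :=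
    (PiLp.continuous_toLp 2 _).measurable.comp_aemeasurable hX
  have hd : AEMeasurable (fun ω => t.ofLp ⬝ᵥ X ω) μ :=
    (show Continuous fun x : Fin p → ℝ => t.ofLp ⬝ᵥ x by
      unfold dotProduct; fun_prop).measurable.comp_aemeasurable hX
  have hi : ∀ ψ : ℝ, Integrable (fun ω => Real.cos (t.ofLp ⬝ᵥ X ω + ψ)) μ := fun ψ =>
    Integrable.of_bound (Real.continuous_cos.measurable.comp_aemeasurable
      (hd.add_const ψ)).aestronglyMeasurable 1 (Eventually.of_forall fun ω => Real.abs_cos_le_one _)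
  rw [charFun_apply, integral_map hm (by fun_prop), ← integral_complex_ofReal,
    ← integral_complex_ofReal, ← integral_mul_const, ← integral_add (hi 0).ofReal
      ((hi _).ofReal.mul_const _)]
  refine integral_congr_ae (Eventually.of_forall fun ω => ?_)
  simp only
  rw [← sub_eq_add_neg, Real.cos_sub_pi_div_two, add_zero, Complex.exp_mul_I, Complex.ofReal_cos,
    Complex.ofReal_sin]
  have : inner ℝ (WithLp.toLp 2 (X ω)) t = t.ofLp ⬝ᵥ X ω := by
    simp [PiLp.inner_apply, dotProduct]
  rw [this]

/-- Lévy continuity is applied in Euclidean space, where the characteristic function has its inner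
product; the result is carried back by the continuous identification with `Fin p → ℝ`. -/
theorem tendstoInDistribution_standardized {c : ℝ} (hc : 0 < c) {d : Fin p → ℕ}
    (hd : Function.Injective d) :
    TendstoInDistribution (fun n => standardized n c d) atTop id
      (fun n => graphLaw n c) (stdNormal p) := by
  have hmeas : ∀ n, AEMeasurable (standardized n c d) (graphLaw n c) := fun n =>
    Measurable.of_discrete.aemeasurable
  have hE : TendstoInDistribution
      (fun n (G : SimpleGraph (Fin n)) => WithLp.toLp 2 (standardized n c d G)) atTop
      (fun z : Fin p → ℝ => WithLp.toLp 2 z) (fun n => graphLaw n c) (stdNormal p) := by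
    refine ⟨fun n => Measurable.of_discrete.aemeasurable,
      (PiLp.continuous_toLp 2 _).measurable.aemeasurable, ?_⟩
    refine ProbabilityMeasure.tendsto_of_tendsto_charFun fun t => ?_
    simp only [ProbabilityMeasure.coe_mk]
    rw [charFun_map_eq (stdNormal p) (X := fun z => z) aemeasurable_id t]
    simp only [charFun_map_eq _ (hmeas _) t]
    have hcos := fun ψ => (Complex.continuous_ofReal.tendsto _).comp
      (tendsto_integral_standardized hc hd (hasBoundedPartials_cos_dotProduct t.ofLp ψ))
    exact (hcos 0).add ((hcos _).mul_const Complex.I)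
  exact hE.continuous_comp (PiLp.continuous_ofLp 2 _)

end Convergence

end DegreeCounts

open DegreeCounts in
theorem theorem4p2 :
    -- the mean vector and the covariance matrix of the degree counts
    (∀ (n p : ℕ) (c : ℝ) (d : Fin p → ℕ), 0 < c → c < (n : ℝ) - 1 → Function.Injective d →
      (∀ i, meanVec n c d i = n * beta n c d i) ∧
      (∀ i j, covMatrix n c d i j =
        n * beta n c d i * beta n c d j *
            (((d i : ℝ) - c) * ((d j : ℝ) - c) / (c * (1 - c / ((n : ℝ) - 1))) - 1) +
          (if i = j then 1 else 0) * (n * beta n c d i)) ∧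
      -- when `B` is finite, the covariance matrix is invertible
      ((∀ i, 0 < beta n c d i) → ∑ i, beta n c d i < 1 → (covMatrix n c d).PosDef)) ∧
    -- the error bound, with a universal constant
    (∃ M : ℝ, ∀ (n p : ℕ) (c : ℝ) (d : Fin p → ℕ), 1 ≤ p → 0 < c → c < (n : ℝ) - 1 →
      Function.Injective d → (∀ i, 0 < beta n c d i) → ∑ i, beta n c d i < 1 →
      ∀ h : (Fin p → ℝ) → ℝ, HasBoundedPartials h →
        |(∫ G, h (standardized n c d G) ∂(graphLaw n c)) - ∫ z, h z ∂(stdNormal p)| ≤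
          (n : ℝ) ^ (-(1 / 2) : ℝ) * M *
            ((p : ℝ) ^ 3 * bigB n c d * derivNorm 2 h * (1 + c ^ (5 / 2 : ℝ)) *
                (((n : ℝ) - 1) / ((n : ℝ) - 1 - c)) ^ (1 / 2 : ℝ) +
              (p : ℝ) ^ 5 * bigB n c d ^ (3 / 2 : ℝ) * derivNorm 3 h * (1 + c ^ 2))) ∧
    -- asymptotic joint normality
    (∀ (p : ℕ) (c : ℝ) (d : Fin p → ℕ), 0 < c → Function.Injective d →
      TendstoInDistribution (fun n => standardized n c d) atTop id
        (fun n => graphLaw n c) (stdNormal p)) :=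
  ⟨fun _ _ _ _ hc hcn hd => ⟨meanVec_eq hc hcn, covMatrix_eq hc hcn hd,
      covMatrix_posDef hc hcn hd⟩,
    ⟨64, fun _ _ _ _ hp hc hcn hd hβ hs _ H =>
      abs_integral_standardized_sub_le hp hc hcn hd hβ hs H⟩,
    fun _ _ _ hc hd => tendstoInDistribution_standardized hc hd⟩
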